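/- For $n\ge 1$ let $F_n$ be the directed bipartite graph on $U_n=\{a_1,\dots,a_n\}\cup\{b_1,\dots,b_n\}$ with the arcs $a_i\to b_j$ for $i\le j$ and $b_j\to a_i$ for $j<i$, every arc having capacity $1$. For an integer $k\ge 0$, a $k$-flow on $U_\ell$ ($\ell\ge 1$) is a set $X$ of arcs of $F_\ell$ such that, when $k$ units are injected at the single source $a_1$ and every arc of $X$ carries one unit, the amount $\operatorname{exc}_X(v)=k\cdot[v=a_1]+\varrho_X(v)-\delta_X(v)$ (with $\varrho_X,\delta_X$ the in- and out-degree in $X$) that terminates at $v$ is non-negative for every $v\in U_\ell$. Let $\mathcal T_k$ be the set of pairs $(R,Q)$ of finite multisets of positive integers such that the sum of all elements of $R$ and $Q$ is $k$. The type of a $k$-flow $X$ on $U_\ell$ is the pair $(R,Q)\in\mathcal T_k$ where $R$ (respectively $Q$) is the multiset of the non-zero values of $\operatorname{exc}_X$ on $a_1,\dots,a_\ell$ (respectively on $b_1,\dots,b_\ell$). The type matrix $\mathcal P_k$ is the $\mathcal T_k\times\mathcal T_k$ matrix whose entry at $(T,T')$ is the number of $k$-flows of type $T'$ on $U_{\ell+1}$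 whose restriction to $U_\ell$ is a given $k$-flow of type $T$ on $U_\ell$. For every integer $k\ge 0$, the following holds. The matrix $\mathcal P_k$ is well defined: every $T\in\mathcal T_k$ is the type of a $k$-flow on $U_\ell$ for some $\ell\ge 1$, and the entry at $(T,T')$ does not depend on the choice of $\ell$ or of the $k$-flow of type $T$ on $U_\ell$. Moreover, each of $\mathcal P_k$ and $\mathcal P_{k+1}$ has a positive real eigenvalue, $r_k$ and $r_{k+1}$ respectively, that is strictly larger than the absolute value of each of its other complex eigenvalues (its Perron, i.e. largest, eigenvalue), and $$r_k<r_{k+1}.$$ -/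

import Mathlib

namespace HalfGraphFlow

/-- Vertices: `Sum.inl i` is `a_i` and `Sum.inr j` is `b_j`; only indices `≥ 1` are used. -/
abbrev Vertex : Type := ℕ ⊕ ℕ

/-- The vertex set `U_n = {a_1, …, a_n} ∪ {b_1, …, b_n}`. -/
def U (n : ℕ) : Finset Vertex := (Finset.Icc 1 n).disjSum (Finset.Icc 1 n)

/-- The arc set of the network `F_n` on `U_n`: `a_i → b_j` if `i ≤ j`, and `b_j → a_i` if `j < i`.
All capacities are `1`. For `ℓ ≤ n` the subnetwork `F_n[U_ℓ]` is `F_ℓ`. -/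
def arcs (n : ℕ) : Finset (Vertex × Vertex) :=
  ((Finset.Icc 1 n ×ˢ Finset.Icc 1 n).filter (fun p => p.1 ≤ p.2)).image
      (fun p => (Sum.inl p.1, Sum.inr p.2)) ∪
  ((Finset.Icc 1 n ×ˢ Finset.Icc 1 n).filter (fun p => p.2 < p.1)).image
      (fun p => (Sum.inr p.2, Sum.inl p.1))

/-- In-degree of `v` in the set of arcs `X`. -/
def inDeg (X : Finset (Vertex × Vertex)) (v : Vertex) : ℕ := (X.filter (fun e => e.2 = v)).card

/-- Out-degree of `v` in the set of arcs `X`. -/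
def outDeg (X : Finset (Vertex × Vertex)) (v : Vertex) : ℕ := (X.filter (fun e => e.1 = v)).card

/-- The amount of flow that terminates at `v` when `k` units are injected at `a_1`
and the arcs of `X` carry one unit each. -/
def excess (k : ℕ) (X : Finset (Vertex × Vertex)) (v : Vertex) : ℤ :=
  (if v = Sum.inl 1 then (k : ℤ) else 0) + (inDeg X v : ℤ) - (outDeg X v : ℤ)

/-- `X` is (the arc set of) an integer `k`-flow in `F[U_ℓ]` from the single source `a_1`,
with arbitrarily distributed sinks in `U_ℓ`. -/
def IsFlow (k ℓ : ℕ) (X : Finset (Vertex × Vertex)) : Prop :=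
  1 ≤ ℓ ∧ X ⊆ arcs ℓ ∧ ∀ v ∈ U ℓ, 0 ≤ excess k X v

instance (k ℓ : ℕ) (X : Finset (Vertex × Vertex)) : Decidable (IsFlow k ℓ X) := by
  unfold IsFlow; infer_instance

/-- The set of types `𝒯_k`: pairs `(R, Q)` of multisets of positive integers of total sum `k`,
that is, `R` is a partition of some `m ≤ k` and `Q` is a partition of `k - m`. -/
abbrev FlowType (k : ℕ) : Type :=
  {T : Multiset ℕ × Multiset ℕ //
    (∀ x ∈ T.1, 0 < x) ∧ (∀ x ∈ T.2, 0 < x) ∧ T.1.sum + T.2.sum = k}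

noncomputable instance (k : ℕ) : Fintype (FlowType k) :=
  Fintype.ofInjective
    (β := Σ m : Fin (k + 1), Nat.Partition m × Nat.Partition (k - m))
    (fun T => ⟨⟨T.1.1.sum, by have := T.2.2.2; omega⟩,
      ⟨T.1.1, fun {i} hi => T.2.1 i hi, rfl⟩,
      ⟨T.1.2, fun {i} hi => T.2.2.1 i hi, by have := T.2.2.2; simp only; omega⟩⟩)
    (by
      intro S T h
      have h1 := congrArg (fun z => z.2.1.parts) h
      have h2 := congrArg (fun z => z.2.2.parts) h
      exact Subtype.ext (Prod.ext h1 h2))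

/-- `X` has type `T = (R, Q)` on `U_ℓ`: the nonzero amounts terminating at the vertices
`a_1, …, a_ℓ` form the multiset `R`, those at `b_1, …, b_ℓ` form the multiset `Q`. -/
def HasType (k ℓ : ℕ) (X : Finset (Vertex × Vertex)) (T : FlowType k) : Prop :=
  ((Finset.Icc 1 ℓ).val.map (fun i => excess k X (Sum.inl i))).filter (fun c => c ≠ 0)
      = T.1.1.map (fun x => (x : ℤ)) ∧
  ((Finset.Icc 1 ℓ).val.map (fun i => excess k X (Sum.inr i))).filter (fun c => c ≠ 0)
      = T.1.2.map (fun x => (x : ℤ))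

instance (k ℓ : ℕ) (X : Finset (Vertex × Vertex)) (T : FlowType k) :
    Decidable (HasType k ℓ X T) := by
  unfold HasType; infer_instance

/-- The arcs of `Y` with both ends in `U_ℓ`. -/
def induced (ℓ : ℕ) (Y : Finset (Vertex × Vertex)) : Finset (Vertex × Vertex) :=
  Y.filter (fun e => e.1 ∈ U ℓ ∧ e.2 ∈ U ℓ)

/-- The number of `k`-flows of type `T` on `U_{ℓ+1}` which extend the `k`-flow `X` on `U_ℓ`. -/
def extensionCount (k ℓ : ℕ) (X : Finset (Vertex × Vertex)) (T : FlowType k) : ℕ :=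
  ((arcs (ℓ + 1)).powerset.filter
    (fun Y => IsFlow k (ℓ + 1) Y ∧ induced ℓ Y = X ∧ HasType k (ℓ + 1) Y T)).card

/-- A choice of a number `ℓ` and a `k`-flow on `U_ℓ` of type `T`. -/
noncomputable def someFlow (k : ℕ) (T : FlowType k) : ℕ × Finset (Vertex × Vertex) :=
  Classical.epsilon (fun p => IsFlow k p.1 p.2 ∧ HasType k p.1 p.2 T)

/-- The type matrix `𝒫_k`: its entry `(T, T')` is the number of ways in which a `k`-flow of
type `T` on `U_ℓ` can be extended to a `k`-flow of type `T'` on `U_{ℓ+1}`. -/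
noncomputable def typeMatrix (k : ℕ) : Matrix (FlowType k) (FlowType k) ℝ :=
  Matrix.of fun T T' => (extensionCount k (someFlow k T).1 (someFlow k T).2 T' : ℝ)

/-- The type matrix is well defined: every type is the type of some `k`-flow, and the number of
extensions of type `T'` is the same for all `ℓ` and all `k`-flows of type `T` on `U_ℓ`. -/
def TypeMatrixWellDefined (k : ℕ) : Prop :=
  ∀ T : FlowType k,
    (∃ ℓ X, IsFlow k ℓ X ∧ HasType k ℓ X T) ∧
    ∀ ℓ X, IsFlow k ℓ X → HasType k ℓ X T →
      ∀ T' : FlowType k, (extensionCount k ℓ X T' : ℝ) = typeMatrix k T T'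

/-- `r` is the Perron (largest) eigenvalue of `M`: a positive real eigenvalue which is strictly
larger than the absolute value of every other complex eigenvalue. -/
def IsPerronEigenvalue {ι : Type*} [Fintype ι] [DecidableEq ι] (M : Matrix ι ι ℝ) (r : ℝ) : Prop :=
  0 < r ∧ Module.End.HasEigenvalue (Matrix.toLin' M) r ∧
  ∀ μ : ℂ, Module.End.HasEigenvalue (Matrix.toLin' (M.map Complex.ofReal)) μ →
    μ ≠ (r : ℂ) → ‖μ‖ < r

end HalfGraphFlow

/-! A flow on `U_ℓ` is extended by choosing a set of the `a`s and a set of the `b`s at which flow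
terminates, moving one unit from each chosen `a` to the new `b` and from each chosen `b` to the new
`a`, and possibly passing one unit from the new `a` to the new `b`. This involves only the amounts
that terminate, so the entry at `(T, T')` is the multiplicity of `T'` in the multiset `moves T`
(`extensionCount_eq_count`), and the matrix is well defined once every type is known to occur.

The matrix is non-negative. Choosing nothing makes its diagonal at least one, and every type can be
dissolved into single units at the `b`s and rebuilt into any other, so it is irreducible
(`IsTypeOf.reach`). Perron–Frobenius theory then gives a dominant eigenvalue `r`, characterised by
Collatz–Wielandt: `c ≤ r` whenever `c • x ≤ A *ᵥ x` for some non-zero `x ≥ 0`.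

To compare `k` with `k + 1`, take a positive eigenvector `v` for `k` and let `w S` be the maximum of
`v T` over the types `T` obtained from `S` by removing one unit. Every move from `T` can be imitated
from `S` so that the results again differ by one unit (`sum_map_moves_le`). Hence `r • w ≤ A *ᵥ w`
for the larger matrix. At the type consisting of single units the inequality is strict, since
decrementing the extra unit is a further move. Irreducibility turns one strict coordinate into a
strictly larger constant, so the next eigenvalue exceeds `r`. -/

namespace HalfGraphFlow

open Matrix

/-! ### Perron–Frobenius theory for irreducible matrices with diagonal at least one -/

section Perron

variable {ι : Type*} [Fintype ι] [DecidableEq ι] {A : Matrix ι ι ℝ}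

/-- A walk from `i` to `j` can be prolonged by waiting at `j`, at no loss because the diagonal entry
is at least one. -/
theorem pow_entry_mono (hA : ∀ i j, 0 ≤ A i j) (hd : ∀ i, 1 ≤ A i i) (i j : ι) :
    Monotone fun n : ℕ => (A ^ n) i j := by
  have hpow : ∀ n i j, 0 ≤ (A ^ n) i j := by
    intro n
    induction n with
    | zero => intro i j; rw [pow_zero, Matrix.one_apply]; split_ifs <;> norm_num
    | succ n ih =>
      intro i j
      rw [pow_succ, Matrix.mul_apply]
      exact Finset.sum_nonneg fun l _ => mul_nonneg (ih i l) (hA l j)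
  refine monotone_nat_of_le_succ fun n => ?_
  simp only [pow_succ, Matrix.mul_apply]
  calc (A ^ n) i j ≤ (A ^ n) i j * A j j := le_mul_of_one_le_right (hpow n i j) (hd j)
    _ ≤ ∑ l, (A ^ n) i l * A l j :=
      Finset.single_le_sum (f := fun l => (A ^ n) i l * A l j)
        (fun l _ => mul_nonneg (hpow n i l) (hA l j)) (Finset.mem_univ j)

/-- Irreducibility gives an exponent for each pair; by monotonicity the largest of them serves all
pairs. -/
theorem exists_pow_pos (hA : ∀ i j, 0 ≤ A i j) (hd : ∀ i, 1 ≤ A i i)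
    (hirr : ∀ i j, Relation.ReflTransGen (fun i j => 0 < A i j) i j) :
    ∃ N : ℕ, ∀ i j, 0 < (A ^ N) i j := by
  have h0 : ∀ n i j, 0 ≤ (A ^ n) i j := fun n i j =>
    le_trans (by simp only [pow_zero, Matrix.one_apply]; split_ifs <;> norm_num)
      (pow_entry_mono hA hd i j (Nat.zero_le n))
  have h1 : ∀ i j, ∃ n : ℕ, 0 < (A ^ n) i j := by
    intro i j
    induction hirr i j with
    | refl => exact ⟨0, by simp⟩
    | @tail l m _ hlm ih =>
      obtain ⟨n, hn⟩ := ih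
      refine ⟨n + 1, ?_⟩
      rw [pow_succ, Matrix.mul_apply]
      exact Finset.sum_pos' (fun a _ => mul_nonneg (h0 n i a) (hA a m))
        ⟨l, Finset.mem_univ l, mul_pos hn hlm⟩
  choose n hn using h1
  refine ⟨Finset.univ.sup fun p : ι × ι => n p.1 p.2, fun i j => ?_⟩
  exact (hn i j).trans_le (pow_entry_mono hA hd i j
    (Finset.le_sup (f := fun p : ι × ι => n p.1 p.2) (Finset.mem_univ (i, j))))

omit [DecidableEq ι] in
theorem mulVec_pos_of_pos {B : Matrix ι ι ℝ} (hB : ∀ i j, 0 < B i j) {x : ι → ℝ} (hx : 0 ≤ x)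
    (hx0 : x ≠ 0) (i : ι) : 0 < (B *ᵥ x) i := by
  obtain ⟨j, hj⟩ := Function.ne_iff.1 hx0
  exact Finset.sum_pos' (fun l _ => mul_nonneg (hB i l).le (hx l))
    ⟨j, Finset.mem_univ j, mul_pos (hB i j) (lt_of_le_of_ne (hx j) (Ne.symm hj))⟩

/-- A strictly subinvariant vector yields a larger subinvariance constant. -/
theorem exists_larger_subinvariant [Nonempty ι] (hA : ∀ i j, 0 ≤ A i j) (hd : ∀ i, 1 ≤ A i i)
    (hirr : ∀ i j, Relation.ReflTransGen (fun i j => 0 < A i j) i j) {c : ℝ} {x : ι → ℝ}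
    (hx : 0 ≤ x) (hx0 : x ≠ 0) (hc : c • x ≤ A *ᵥ x) (hne : A *ᵥ x ≠ c • x) :
    ∃ d > c, ∃ y : ι → ℝ, 0 ≤ y ∧ y ≠ 0 ∧ d • y ≤ A *ᵥ y := by
  obtain ⟨N, hN⟩ := exists_pow_pos hA hd hirr
  set y := (A ^ N) *ᵥ x with hy
  have hypos : ∀ i, 0 < y i := mulVec_pos_of_pos hN hx hx0
  -- `A y - c y` equals `A ^ N` applied to the non-zero, non-negative vector `A x - c x`.
  have hdiff : ∀ i, 0 < (A *ᵥ y) i - c * y i := by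
    intro i
    have := mulVec_pos_of_pos hN (sub_nonneg.2 hc) (sub_ne_zero.2 hne) i
    rw [Matrix.mulVec_sub, Matrix.mulVec_smul, Matrix.mulVec_mulVec, ← pow_succ, pow_succ',
      ← Matrix.mulVec_mulVec, ← hy] at this
    simpa using this
  -- The constant can be raised by the smallest relative slack.
  obtain ⟨i₀, -, hi₀⟩ := Finset.exists_min_image Finset.univ
    (fun i => ((A *ᵥ y) i - c * y i) / y i) Finset.univ_nonempty
  refine ⟨c + ((A *ᵥ y) i₀ - c * y i₀) / y i₀,
    lt_add_of_pos_right _ (div_pos (hdiff i₀) (hypos i₀)), y, fun i => (hypos i).le,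
    fun h => (hypos i₀).ne' (congrFun h i₀), fun i => ?_⟩
  have := (le_div_iff₀ (hypos i)).1 (hi₀ i (Finset.mem_univ i))
  simp only [Pi.smul_apply, smul_eq_mul]
  linarith

/-- The Collatz–Wielandt characterisation of the largest eigenvalue. -/
theorem exists_collatzWielandt [Nonempty ι] (hA : ∀ i j, 0 ≤ A i j) (hd : ∀ i, 1 ≤ A i i)
    (hirr : ∀ i j, Relation.ReflTransGen (fun i j => 0 < A i j) i j) :
    ∃ r : ℝ, ∃ v : ι → ℝ, 1 ≤ r ∧ (∀ i, 0 < v i) ∧ A *ᵥ v = r • v ∧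
      ∀ (c : ℝ) (x : ι → ℝ), 0 ≤ x → x ≠ 0 → c • x ≤ A *ᵥ x → c ≤ r := by
  set b : ℝ := ∑ i, ∑ j, A i j with hb
  have hbound : ∀ (c : ℝ), ∀ x ∈ stdSimplex ℝ ι, c • x ≤ A *ᵥ x → c ≤ b := by
    intro c x hx hc
    have h1 : ∑ i, c * x i ≤ ∑ i, (A *ᵥ x) i := Finset.sum_le_sum fun i _ => hc i
    rw [← Finset.mul_sum, hx.2, mul_one] at h1
    refine h1.trans (Finset.sum_le_sum fun i _ => Finset.sum_le_sum fun j _ => ?_)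
    refine mul_le_of_le_one_right (hA i j) ?_
    rw [← hx.2]
    exact Finset.single_le_sum (f := x) (fun l _ => hx.1 l) (Finset.mem_univ j)
  -- Maximising the constant jointly with the normalised vector makes the problem a linear objective
  -- on a compact set. Constants below one can be ignored, since `x ≤ A *ᵥ x` for all `x ≥ 0`.
  set K : Set ((ι → ℝ) × ℝ) :=
    (stdSimplex ℝ ι ×ˢ Set.Icc 1 b) ∩ {p | p.2 • p.1 ≤ A *ᵥ p.1} with hK
  have hKc : IsCompact K := by
    refine ((isCompact_stdSimplex ℝ ι).prod isCompact_Icc).inter_right ?_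
    refine isClosed_le (by fun_prop) ?_
    exact Continuous.matrix_mulVec continuous_const continuous_fst
  have hone : ∀ x : ι → ℝ, 0 ≤ x → (1 : ℝ) • x ≤ A *ᵥ x := by
    intro x hx i
    rw [one_smul]
    calc x i ≤ A i i * x i := le_mul_of_one_le_left (hx i) (hd i)
      _ ≤ (A *ᵥ x) i := Finset.single_le_sum (f := fun j => A i j * x j)
        (fun j _ => mul_nonneg (hA i j) (hx j)) (Finset.mem_univ i)
  have hKn : K.Nonempty := by
    obtain ⟨i⟩ := ‹Nonempty ι›
    have hs := single_mem_stdSimplex ℝ i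
    exact ⟨(Pi.single i 1, 1), ⟨hs, le_rfl, hbound 1 _ hs (hone _ hs.1)⟩, hone _ hs.1⟩
  obtain ⟨⟨v, r⟩, ⟨⟨hv, hr⟩, hvr⟩, hmax⟩ := hKc.exists_isMaxOn hKn continuous_snd.continuousOn
  simp only [Set.mem_ofPred_eq] at hvr hv hr
  have hcw : ∀ (c : ℝ) (x : ι → ℝ), 0 ≤ x → x ≠ 0 → c • x ≤ A *ᵥ x → c ≤ r := by
    intro c x hx hx0 hc
    rcases le_total c 1 with h1 | h1
    · exact h1.trans hr.1
    · obtain ⟨j, hj⟩ := Function.ne_iff.1 hx0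
      have hs : 0 < ∑ i, x i := Finset.sum_pos' (fun i _ => hx i)
        ⟨j, Finset.mem_univ j, lt_of_le_of_ne (hx j) (Ne.symm hj)⟩
      have hsx : (∑ i, x i)⁻¹ • x ∈ stdSimplex ℝ ι := by
        refine ⟨fun i => mul_nonneg (inv_nonneg.2 hs.le) (hx i), ?_⟩
        simp only [Pi.smul_apply, smul_eq_mul, ← Finset.mul_sum]
        exact inv_mul_cancel₀ hs.ne'
      have hcx : c • ((∑ i, x i)⁻¹ • x) ≤ A *ᵥ ((∑ i, x i)⁻¹ • x) := by
        rw [Matrix.mulVec_smul, smul_comm]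
        exact smul_le_smul_of_nonneg_left hc (inv_nonneg.2 hs.le)
      exact hmax (a := ((∑ i, x i)⁻¹ • x, c)) ⟨⟨hsx, h1, hbound c _ hsx hcx⟩, hcx⟩
  have hv0 : v ≠ 0 := by
    rintro rfl
    simpa using hv.2
  -- A maximiser that is not an eigenvector would be strictly subinvariant, and its constant could
  -- be raised.
  have heq : A *ᵥ v = r • v := by
    by_contra hne
    obtain ⟨d, hd', y, hy, hy0, hdy⟩ := exists_larger_subinvariant hA hd hirr hv.1 hv0 hvr hne
    exact absurd (hcw d y hy hy0 hdy) (not_le.2 hd')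
  refine ⟨r, v, hr.1, ?_, heq, hcw⟩
  obtain ⟨N, hN⟩ := exists_pow_pos hA hd hirr
  have hpow : ∀ n : ℕ, (A ^ n) *ᵥ v = r ^ n • v := by
    intro n
    induction n with
    | zero => simp
    | succ n ih => rw [pow_succ, ← Matrix.mulVec_mulVec, heq, Matrix.mulVec_smul, ih, smul_smul,
        pow_succ']
  intro i
  have := mulVec_pos_of_pos hN hv.1 hv0 i
  rw [hpow] at this
  exact pos_of_mul_pos_right this (pow_nonneg (zero_le_one.trans hr.1) N)

/-- The vector of absolute values of an eigenvector is tested twice: for `A` it gives `‖μ‖ ≤ r`, and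
for the still non-negative `A - 1` it gives `‖μ - 1‖ ≤ r - 1`. The disc of radius `r - 1` about `1`
meets the circle of radius `r` about `0` only at `r`. -/
theorem isPerronEigenvalue_of_collatzWielandt {r : ℝ} {v : ι → ℝ} (hA : ∀ i j, 0 ≤ A i j)
    (hd : ∀ i, 1 ≤ A i i) (hr : 1 ≤ r) (hv0 : v ≠ 0) (hv : A *ᵥ v = r • v)
    (hcw : ∀ (c : ℝ) (x : ι → ℝ), 0 ≤ x → x ≠ 0 → c • x ≤ A *ᵥ x → c ≤ r) :
    IsPerronEigenvalue A r := by
  refine ⟨zero_lt_one.trans_le hr, ?_, ?_⟩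
  · exact Module.End.hasEigenvalue_of_hasEigenvector (x := v)
      ⟨Module.End.mem_eigenspace_iff.2 (by rw [Matrix.toLin'_apply, hv]), hv0⟩
  intro μ hμ hne
  obtain ⟨z, hz, hz0⟩ := hμ.exists_hasEigenvector
  rw [Module.End.mem_eigenspace_iff, Matrix.toLin'_apply] at hz
  have hzi : ∀ i, ∑ j, (A i j : ℂ) * z j = μ * z i := fun i => congrFun hz i
  set x : ι → ℝ := fun i => ‖z i‖ with hx
  have hxnn : 0 ≤ x := fun i => norm_nonneg _
  have hx0 : x ≠ 0 := by
    obtain ⟨i, hi⟩ := Function.ne_iff.1 hz0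
    exact Function.ne_iff.2 ⟨i, norm_ne_zero_iff.2 hi⟩
  have h1 : ‖μ‖ ≤ r := by
    refine hcw _ x hxnn hx0 fun i => ?_
    calc ‖μ‖ * ‖z i‖ = ‖∑ j, (A i j : ℂ) * z j‖ := by rw [hzi, norm_mul]
      _ ≤ ∑ j, ‖(A i j : ℂ) * z j‖ := norm_sum_le _ _
      _ = ∑ j, A i j * x j := by
        refine Finset.sum_congr rfl fun j _ => ?_
        rw [norm_mul, Complex.norm_real, Real.norm_of_nonneg (hA i j)]
  have h2 : ‖μ - 1‖ + 1 ≤ r := by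
    refine hcw _ x hxnn hx0 fun i => ?_
    have hsub : (μ - 1) * z i = ((A i i - 1 : ℝ) : ℂ) * z i +
        ∑ j ∈ Finset.univ.erase i, (A i j : ℂ) * z j := by
      rw [sub_mul, ← hzi i, ← Finset.add_sum_erase _ _ (Finset.mem_univ i)]
      push_cast
      ring
    have h3 : ‖μ - 1‖ * x i ≤ (A i i - 1) * x i + ∑ j ∈ Finset.univ.erase i, A i j * x j := by
      rw [hx, ← norm_mul, hsub]
      refine (norm_add_le _ _).trans (add_le_add (le_of_eq ?_) ((norm_sum_le _ _).trans
        (le_of_eq (Finset.sum_congr rfl fun j _ => ?_))))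
      · rw [norm_mul, Complex.norm_real, Real.norm_of_nonneg (sub_nonneg.2 (hd i))]
      · rw [norm_mul, Complex.norm_real, Real.norm_of_nonneg (hA i j)]
    have h4 : (A *ᵥ x) i = A i i * x i + ∑ j ∈ Finset.univ.erase i, A i j * x j :=
      (Finset.add_sum_erase Finset.univ (fun j => A i j * x j) (Finset.mem_univ i)).symm
    rw [h4, Pi.smul_apply, smul_eq_mul]
    linarith
  refine lt_of_le_of_ne h1 fun h => hne ?_
  have h5 : ‖μ - 1‖ ^ 2 ≤ (r - 1) ^ 2 :=
    pow_le_pow_left₀ (norm_nonneg _) (by linarith) 2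
  have h6 : ‖μ‖ ^ 2 = r ^ 2 := by rw [h]
  rw [← Complex.normSq_eq_norm_sq, Complex.normSq_apply] at h5 h6
  simp only [Complex.sub_re, Complex.sub_im, Complex.one_re, Complex.one_im, sub_zero] at h5
  -- Subtracting `‖μ‖ ^ 2 = r ^ 2` from the squared disc inequality leaves `-2 * μ.re ≤ -2 * r`.
  have h7 : r ≤ μ.re := by nlinarith
  have h8 : μ.im = 0 := by nlinarith
  have h9 : μ.re = r := by nlinarith
  exact Complex.ext (by simpa using h9) (by simpa using h8)

end Perron

/-! ### Extensions as moves on pairs of multisets -/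

section Moves

/-- The nonzero elements of a multiset of natural numbers. -/
def dropZeros (s : Multiset ℕ) : Multiset ℕ := s.filter (· ≠ 0)

theorem dropZeros_add (s t : Multiset ℕ) : dropZeros (s + t) = dropZeros s + dropZeros t :=
  Multiset.filter_add _ _ _

theorem dropZeros_cons_succ (x : ℕ) (s : Multiset ℕ) :
    dropZeros ((x + 1) ::ₘ s) = (x + 1) ::ₘ dropZeros s :=
  Multiset.filter_cons_of_pos _ (Nat.succ_ne_zero x)

theorem dropZeros_cons_zero (s : Multiset ℕ) : dropZeros (0 ::ₘ s) = dropZeros s :=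
  Multiset.filter_cons_of_neg _ (by simp)

theorem dropZeros_singleton_zero : dropZeros {0} = 0 := dropZeros_cons_zero 0

theorem dropZeros_of_zero_notMem {s : Multiset ℕ} (h : 0 ∉ s) : dropZeros s = s :=
  Multiset.filter_eq_self.2 fun _ ha h0 => h (h0 ▸ ha)

theorem zero_notMem_dropZeros (s : Multiset ℕ) : 0 ∉ dropZeros s := by simp [dropZeros]

theorem dropZeros_dropZeros (s : Multiset ℕ) : dropZeros (dropZeros s) = dropZeros s :=
  dropZeros_of_zero_notMem (zero_notMem_dropZeros s)

theorem dropZeros_cons_dropZeros (x : ℕ) (s : Multiset ℕ) :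
    dropZeros (x ::ₘ dropZeros s) = dropZeros (x ::ₘ s) := by
  rw [← Multiset.singleton_add, ← Multiset.singleton_add, dropZeros_add, dropZeros_add,
    dropZeros_dropZeros]

theorem sum_dropZeros (s : Multiset ℕ) : (dropZeros s).sum = s.sum := by
  induction s using Multiset.induction_on with
  | empty => rfl
  | cons a s ih =>
    rcases a with _ | a
    · rw [dropZeros_cons_zero, ih]; simp
    · rw [dropZeros_cons_succ, Multiset.sum_cons, Multiset.sum_cons, ih]

/-- The result of splitting the amounts at the old `a`s and `b`s into (kept, decremented) parts
`p` and `q` respectively, with `e` units on the arc between the two new vertices. -/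
def moveResult (p q : Multiset ℕ × Multiset ℕ) (e : ℕ) : Multiset ℕ × Multiset ℕ :=
  (dropZeros (p.1 + p.2.map Nat.pred + {Multiset.card q.2 - e}),
    dropZeros (q.1 + q.2.map Nat.pred + {Multiset.card p.2 + e}))

/-- The multiset of the results of all moves from a pair of multisets. -/
def moves (T : Multiset ℕ × Multiset ℕ) : Multiset (Multiset ℕ × Multiset ℕ) :=
  T.1.antidiagonal.bind fun p => T.2.antidiagonal.bind fun q =>
    (Multiset.range (min (Multiset.card q.2) 1 + 1)).map (moveResult p q)

theorem mem_moves {T T' : Multiset ℕ × Multiset ℕ} :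
    T' ∈ moves T ↔ ∃ p q : Multiset ℕ × Multiset ℕ, ∃ e : ℕ, p.1 + p.2 = T.1 ∧ q.1 + q.2 = T.2 ∧
      e ≤ 1 ∧ e ≤ Multiset.card q.2 ∧ moveResult p q e = T' := by
  simp only [moves, Multiset.mem_bind, Multiset.mem_map, Multiset.mem_antidiagonal,
    Multiset.mem_range]
  constructor
  · rintro ⟨p, hp, q, hq, e, he, h⟩
    exact ⟨p, q, e, hp, hq, by omega, by omega, h⟩
  · rintro ⟨p, q, e, hp, hq, he, he', h⟩
    exact ⟨p, hp, q, hq, e, by omega, h⟩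

/-- The property that defines `FlowType k`. -/
def IsTypeOf (k : ℕ) (T : Multiset ℕ × Multiset ℕ) : Prop :=
  (∀ x ∈ T.1, 0 < x) ∧ (∀ x ∈ T.2, 0 < x) ∧ T.1.sum + T.2.sum = k

theorem isTypeOf_iff {k : ℕ} {T : Multiset ℕ × Multiset ℕ} :
    IsTypeOf k T ↔ 0 ∉ T.1 ∧ 0 ∉ T.2 ∧ T.1.sum + T.2.sum = k := by
  have h : ∀ s : Multiset ℕ, (∀ x ∈ s, 0 < x) ↔ 0 ∉ s := fun s =>
    ⟨fun h h0 => (h 0 h0).false, fun h x hx => Nat.pos_of_ne_zero fun h0 => h (h0 ▸ hx)⟩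
  rw [IsTypeOf, h, h]

theorem sum_map_pred_add_card {s : Multiset ℕ} (h : 0 ∉ s) :
    (s.map Nat.pred).sum + Multiset.card s = s.sum := by
  induction s using Multiset.induction_on with
  | empty => rfl
  | cons a s ih =>
    rw [Multiset.mem_cons, not_or] at h
    have := ih h.2
    have := h.1
    simp only [Multiset.map_cons, Multiset.sum_cons, Multiset.card_cons, Nat.pred_eq_sub_one] at *
    omega

/-- The units removed from the decremented elements reappear at the two new vertices; `e ≤ card q.2`
makes the truncated subtraction in `moveResult` exact. -/
theorem IsTypeOf.of_mem_moves {k : ℕ} {T T' : Multiset ℕ × Multiset ℕ} (hT : IsTypeOf k T)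
    (h : T' ∈ moves T) : IsTypeOf k T' := by
  obtain ⟨p, q, e, hp, hq, -, he, rfl⟩ := mem_moves.1 h
  rw [isTypeOf_iff] at hT ⊢
  obtain ⟨h1, h2, h3⟩ := hT
  refine ⟨zero_notMem_dropZeros _, zero_notMem_dropZeros _, ?_⟩
  rw [← hp, Multiset.mem_add, not_or] at h1
  rw [← hq, Multiset.mem_add, not_or] at h2
  rw [← hp, ← hq, Multiset.sum_add, Multiset.sum_add] at h3
  have := sum_map_pred_add_card h1.2
  have := sum_map_pred_add_card h2.2
  simp only [moveResult, sum_dropZeros, Multiset.sum_add, Multiset.sum_singleton]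
  omega

theorem self_mem_moves {k : ℕ} {T : Multiset ℕ × Multiset ℕ} (hT : IsTypeOf k T) :
    T ∈ moves T := by
  rw [isTypeOf_iff] at hT
  refine mem_moves.2 ⟨(T.1, 0), (T.2, 0), 0, by simp, by simp, by simp, by simp, ?_⟩
  simp [moveResult, dropZeros_add, dropZeros_of_zero_notMem hT.1, dropZeros_singleton_zero,
    dropZeros_of_zero_notMem hT.2.1]

end Moves

/-! ### Any type can be reached from any other -/

section Reachability

/-- `T'` can be reached from `T` by a sequence of moves. -/
abbrev Reach : Multiset ℕ × Multiset ℕ → Multiset ℕ × Multiset ℕ → Prop :=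
  Relation.ReflTransGen fun T T' => T' ∈ moves T

variable {R Q : Multiset ℕ}

theorem dropZeros_pos_singleton {m : ℕ} (h : 0 < m) : dropZeros {m} = {m} :=
  dropZeros_of_zero_notMem (by simp; omega)

theorem dropZeros_replicate_zero (m : ℕ) : dropZeros (Multiset.replicate m 0) = 0 :=
  Multiset.filter_eq_nil.2 fun _ h => not_not.2 (Multiset.eq_of_mem_replicate h)

theorem mem_moves_decrement_left (hR : 0 ∉ R) (hQ : 0 ∉ Q) (r : ℕ) :
    (dropZeros (r ::ₘ R), 1 ::ₘ Q) ∈ moves ((r + 1) ::ₘ R, Q) := by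
  refine mem_moves.2 ⟨(R, {r + 1}), (Q, 0), 0, by simp [← Multiset.singleton_add, add_comm], by simp,
    by simp, by simp, ?_⟩
  simp [moveResult, dropZeros_add, dropZeros_of_zero_notMem hR, dropZeros_singleton_zero,
    dropZeros_of_zero_notMem hQ, dropZeros_pos_singleton, ← Multiset.singleton_add, add_comm]

/-- With `e = 1` the unit taken from an old `b` passes through the new `a` to the new `b`, and
nothing stays at the new `a`. -/
theorem mem_moves_decrement_right (hR : 0 ∉ R) (hQ : 0 ∉ Q) (r : ℕ) :
    (R, 1 ::ₘ dropZeros (r ::ₘ Q)) ∈ moves (R, (r + 1) ::ₘ Q) := by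
  refine mem_moves.2 ⟨(R, 0), (Q, {r + 1}), 1, by simp, by simp [← Multiset.singleton_add, add_comm],
    by simp, by simp, ?_⟩
  simp [moveResult, dropZeros_add, dropZeros_of_zero_notMem hR, dropZeros_singleton_zero,
    dropZeros_of_zero_notMem hQ, dropZeros_pos_singleton, ← Multiset.singleton_add, add_comm]

theorem mem_moves_collect_left (hR : 0 ∉ R) (hQ : 0 ∉ Q) {m : ℕ} (hm : 0 < m) :
    (m ::ₘ R, Q) ∈ moves (R, Q + Multiset.replicate m 1) := by
  refine mem_moves.2 ⟨(R, 0), (Q, Multiset.replicate m 1), 0, by simp, by simp, by simp,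
    by simp, ?_⟩
  simp [moveResult, dropZeros_add, dropZeros_of_zero_notMem hR, dropZeros_singleton_zero,
    dropZeros_of_zero_notMem hQ, dropZeros_pos_singleton hm, ← Multiset.singleton_add, add_comm,
    dropZeros_replicate_zero]

theorem mem_moves_collect_right (hR : 0 ∉ R) (hQ : 0 ∉ Q) {m : ℕ} (hm : 0 < m) :
    (R, m ::ₘ Q) ∈ moves (R + Multiset.replicate m 1, Q) := by
  refine mem_moves.2 ⟨(R, Multiset.replicate m 1), (Q, 0), 0, by simp, by simp, by simp,
    by simp, ?_⟩
  simp [moveResult, dropZeros_add, dropZeros_of_zero_notMem hR, dropZeros_singleton_zero,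
    dropZeros_of_zero_notMem hQ, dropZeros_pos_singleton hm, ← Multiset.singleton_add, add_comm,
    dropZeros_replicate_zero]

theorem zero_notMem_add {s t : Multiset ℕ} (hs : 0 ∉ s) (ht : 0 ∉ t) : 0 ∉ s + t := by
  simp [hs, ht]

theorem zero_notMem_replicate_one (m : ℕ) : 0 ∉ Multiset.replicate m 1 := fun h =>
  zero_ne_one (Multiset.eq_of_mem_replicate h)

theorem reach_dissolve_left_element (hR : 0 ∉ R) (r : ℕ) : ∀ {Q : Multiset ℕ}, 0 ∉ Q →
    Reach ((r + 1) ::ₘ R, Q) (R, Q + Multiset.replicate (r + 1) 1) := by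
  induction r with
  | zero =>
    intro Q hQ
    refine .single ?_
    have := mem_moves_decrement_left hR hQ 0
    rwa [dropZeros_cons_zero, dropZeros_of_zero_notMem hR, ← Multiset.singleton_add 1 Q,
      add_comm {1} Q, ← Multiset.replicate_one] at this
  | succ r ih =>
    intro Q hQ
    refine .head (mem_moves_decrement_left hR hQ (r + 1)) ?_
    rw [dropZeros_cons_succ, dropZeros_of_zero_notMem hR]
    convert ih (Q := 1 ::ₘ Q) (by simp [hQ]) using 2
    rw [Multiset.replicate_succ, Multiset.add_cons, Multiset.cons_add]

theorem reach_dissolve_right_element (hR : 0 ∉ R) (r : ℕ) : ∀ {Q : Multiset ℕ}, 0 ∉ Q →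
    Reach (R, (r + 1) ::ₘ Q) (R, Q + Multiset.replicate (r + 1) 1) := by
  induction r with
  | zero =>
    intro Q hQ
    rw [zero_add, Multiset.replicate_one, add_comm Q, Multiset.singleton_add]
  | succ r ih =>
    intro Q hQ
    refine .head (mem_moves_decrement_right hR hQ (r + 1)) ?_
    rw [dropZeros_cons_succ, dropZeros_of_zero_notMem hQ, Multiset.cons_swap]
    convert ih (Q := 1 ::ₘ Q) (by simp [hQ]) using 2
    rw [Multiset.replicate_succ, Multiset.add_cons, Multiset.cons_add]

theorem reach_dissolve_left (hR : 0 ∉ R) : ∀ {Q : Multiset ℕ}, 0 ∉ Q →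
    Reach (R, Q) (0, Q + Multiset.replicate R.sum 1) := by
  induction R using Multiset.induction_on with
  | empty => intro Q _; simpa using Relation.ReflTransGen.refl
  | cons a R ih =>
    intro Q hQ
    rw [Multiset.mem_cons, not_or] at hR
    obtain ⟨r, rfl⟩ := Nat.exists_eq_succ_of_ne_zero (Ne.symm hR.1)
    refine (reach_dissolve_left_element hR.2 r hQ).trans ?_
    have := ih hR.2 (zero_notMem_add hQ (zero_notMem_replicate_one (r + 1)))
    rwa [add_assoc, ← Multiset.replicate_add, ← Multiset.sum_cons] at this

theorem reach_dissolve_right (hQ : 0 ∉ Q) : ∀ {Q' : Multiset ℕ}, 0 ∉ Q' →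
    Reach (0, Q' + Q) (0, Q' + Multiset.replicate Q.sum 1) := by
  induction Q using Multiset.induction_on with
  | empty => intro Q' _; simpa using Relation.ReflTransGen.refl
  | cons a Q ih =>
    intro Q' hQ'
    rw [Multiset.mem_cons, not_or] at hQ
    obtain ⟨r, rfl⟩ := Nat.exists_eq_succ_of_ne_zero (Ne.symm hQ.1)
    rw [Multiset.add_cons]
    refine (reach_dissolve_right_element (by simp) r (zero_notMem_add hQ' hQ.2)).trans ?_
    have := ih hQ.2 (zero_notMem_add hQ' (zero_notMem_replicate_one (r + 1)))
    rwa [add_assoc, add_assoc, ← Multiset.replicate_add, add_comm _ Q, ← add_assoc,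
      ← Multiset.sum_cons] at this

theorem reach_assemble_left {S : Multiset ℕ} (hS : 0 ∉ S) (hQ : 0 ∉ Q) :
    ∀ {R : Multiset ℕ}, 0 ∉ R → Reach (R, Q + Multiset.replicate S.sum 1) (R + S, Q) := by
  induction S using Multiset.induction_on with
  | empty => intro R _; simpa using Relation.ReflTransGen.refl
  | cons a S ih =>
    intro R hR
    rw [Multiset.mem_cons, not_or] at hS
    have h1 := mem_moves_collect_left hR (zero_notMem_add hQ (zero_notMem_replicate_one S.sum))
      (Nat.pos_of_ne_zero (Ne.symm hS.1))
    rw [add_assoc, ← Multiset.replicate_add, add_comm _ a, ← Multiset.sum_cons] at h1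
    refine .head h1 ?_
    convert ih hS.2 (R := a ::ₘ R) (by simp [hR, hS.1]) using 2
    rw [Multiset.add_cons, Multiset.cons_add]

/-- A move delivers to the new `b` any number of units from the `a`s, but at most one coming from
the `b`s. So the units for one element are first carried one by one to the `a`s and then collected.
-/
theorem reach_assemble_right {S : Multiset ℕ} (hS : 0 ∉ S) (hR : 0 ∉ R) :
    ∀ {Q : Multiset ℕ}, 0 ∉ Q → Reach (R, Q + Multiset.replicate S.sum 1) (R, Q + S) := by
  induction S using Multiset.induction_on with
  | empty => intro Q _; simpa using Relation.ReflTransGen.refl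
  | cons a S ih =>
    intro Q hQ
    rw [Multiset.mem_cons, not_or] at hS
    have hrest := zero_notMem_add hQ (zero_notMem_replicate_one S.sum)
    have h1 := reach_assemble_left (zero_notMem_replicate_one a) hrest hR
    rw [Multiset.sum_replicate, smul_eq_mul, mul_one, add_assoc, ← Multiset.replicate_add,
      add_comm _ a, ← Multiset.sum_cons] at h1
    refine h1.trans (.head (mem_moves_collect_right hR hrest
      (Nat.pos_of_ne_zero (Ne.symm hS.1))) ?_)
    have := ih hS.2 (Q := a ::ₘ Q) (by simp [hQ, hS.1])
    rwa [Multiset.cons_add, Multiset.cons_add, ← Multiset.add_cons a Q S] at this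

/-- The route goes through the pair with no amounts at the `a`s and `k` single units at the `b`s. -/
theorem IsTypeOf.reach {k : ℕ} {T T' : Multiset ℕ × Multiset ℕ} (hT : IsTypeOf k T)
    (hT' : IsTypeOf k T') : Reach T T' := by
  obtain ⟨R, Q⟩ := T
  obtain ⟨R', Q'⟩ := T'
  rw [isTypeOf_iff] at hT hT'
  simp only at hT hT'
  have h1 := reach_dissolve_left hT.1 hT.2.1
  rw [add_comm Q] at h1
  have h2 := reach_dissolve_right hT.2.1 (zero_notMem_replicate_one R.sum)
  rw [← Multiset.replicate_add, hT.2.2, ← hT'.2.2, Multiset.replicate_add] at h2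
  have h3 := reach_assemble_right hT'.2.1 (R := 0) (by simp) (zero_notMem_replicate_one R'.sum)
  have h4 := reach_assemble_left hT'.1 hT'.2.1 (R := 0) (by simp)
  rw [zero_add, add_comm Q'] at h4
  exact h1.trans (h2.trans (h3.trans h4))

end Reachability

/-! ### Comparing the moves of types that differ by one unit -/

section Covering

/-- `S` is obtained from `T` by adding one unit at some (possibly new) element. -/
def Covers (S T : Multiset ℕ × Multiset ℕ) : Prop :=
  ∃ (x : ℕ) (U V : Multiset ℕ), 0 ∉ U ∧
    ((S = ((x + 1) ::ₘ U, V) ∧ T = (dropZeros (x ::ₘ U), V)) ∨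
      (S = (V, (x + 1) ::ₘ U) ∧ T = (V, dropZeros (x ::ₘ U))))

theorem Covers.isTypeOf_iff {k : ℕ} {S T : Multiset ℕ × Multiset ℕ} (h : Covers S T) :
    IsTypeOf (k + 1) S ↔ IsTypeOf k T := by
  rw [HalfGraphFlow.isTypeOf_iff, HalfGraphFlow.isTypeOf_iff]
  obtain ⟨x, U, V, hU, ⟨rfl, rfl⟩ | ⟨rfl, rfl⟩⟩ := h
  all_goals
    simp only [Multiset.mem_cons, hU, or_false, zero_notMem_dropZeros, not_false_eq_true, true_and,
      sum_dropZeros, Multiset.sum_cons, (Nat.succ_ne_zero x).symm]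
    refine and_congr_right fun _ => ?_
    omega

theorem exists_covers {k : ℕ} {S : Multiset ℕ × Multiset ℕ} (hS : IsTypeOf (k + 1) S) :
    ∃ T, Covers S T := by
  obtain ⟨R, Q⟩ := S
  rw [HalfGraphFlow.isTypeOf_iff] at hS
  obtain ⟨hR, hQ, hsum⟩ := hS
  simp only at hR hQ hsum
  rcases R.empty_or_exists_mem with rfl | ⟨a, ha⟩
  · rcases Q.empty_or_exists_mem with rfl | ⟨a, ha⟩
    · simp at hsum
    · obtain ⟨U, rfl⟩ := Multiset.exists_cons_of_mem ha
      rw [Multiset.mem_cons, not_or] at hQ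
      obtain ⟨x, rfl⟩ := Nat.exists_eq_succ_of_ne_zero (Ne.symm hQ.1)
      exact ⟨_, x, U, 0, hQ.2, .inr ⟨rfl, rfl⟩⟩
  · obtain ⟨U, rfl⟩ := Multiset.exists_cons_of_mem ha
    rw [Multiset.mem_cons, not_or] at hR
    obtain ⟨x, rfl⟩ := Nat.exists_eq_succ_of_ne_zero (Ne.symm hR.1)
    exact ⟨_, x, U, Q, hR.2, .inl ⟨rfl, rfl⟩⟩

theorem covers_dropZeros_left (x : ℕ) (Z V : Multiset ℕ) :
    Covers (dropZeros ((x + 1) ::ₘ Z), V) (dropZeros (x ::ₘ Z), V) := by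
  refine ⟨x, dropZeros Z, V, zero_notMem_dropZeros Z, .inl ⟨?_, ?_⟩⟩
  · rw [dropZeros_cons_succ]
  · rw [dropZeros_cons_dropZeros]

theorem covers_dropZeros_right (x : ℕ) (Z V : Multiset ℕ) :
    Covers (V, dropZeros ((x + 1) ::ₘ Z)) (V, dropZeros (x ::ₘ Z)) := by
  refine ⟨x, dropZeros Z, V, zero_notMem_dropZeros Z, .inr ⟨?_, ?_⟩⟩
  · rw [dropZeros_cons_succ]
  · rw [dropZeros_cons_dropZeros]

variable {f g : Multiset ℕ × Multiset ℕ → ℝ}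

/-- The sum of `f` over all moves with a given splitting of both sides. -/
def arcSum (f : Multiset ℕ × Multiset ℕ → ℝ) (p q : Multiset ℕ × Multiset ℕ) : ℝ :=
  ((Multiset.range (min (Multiset.card q.2) 1 + 1)).map fun e => f (moveResult p q e)).sum

theorem sum_map_moves (R Q : Multiset ℕ) : ((moves (R, Q)).map f).sum =
    (R.antidiagonal.map fun p => (Q.antidiagonal.map fun q => arcSum f p q).sum).sum := by
  simp only [moves, Multiset.map_bind, Multiset.sum_bind, Multiset.map_map, arcSum,
    Function.comp_def]

theorem arcSum_nonneg (hg : ∀ S, 0 ≤ g S) (p q : Multiset ℕ × Multiset ℕ) : 0 ≤ arcSum g p q :=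
  Multiset.sum_nonneg (by simp only [Multiset.mem_map]; rintro _ ⟨e, -, rfl⟩; exact hg _)

theorem arcSum_le_arcSum {p q p' q' : Multiset ℕ × Multiset ℕ}
    (hcard : Multiset.card q.2 = Multiset.card q'.2)
    (h : ∀ e, f (moveResult p q e) ≤ g (moveResult p' q' e)) : arcSum f p q ≤ arcSum g p' q' := by
  rw [arcSum, arcSum, hcard]
  exact Multiset.sum_map_le_sum_map _ _ fun e _ => h e

variable (hfg : ∀ S T, Covers S T → f T ≤ g S)
include hfg

/-- In this and the next three lemmas the element carrying the extra unit receives the same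
treatment, kept or decremented, on both sides. The number of chosen elements and the range of `e`
therefore agree, and the results still differ by one unit. -/
theorem arcSum_keep_left (x : ℕ) (p q : Multiset ℕ × Multiset ℕ) :
    arcSum f (x ::ₘ p.1, p.2) q ≤ arcSum g ((x + 1) ::ₘ p.1, p.2) q := by
  refine arcSum_le_arcSum rfl fun e => hfg _ _ ?_
  simp only [moveResult, Multiset.cons_add]
  exact covers_dropZeros_left _ _ _

theorem arcSum_decrement_left (x : ℕ) (p q : Multiset ℕ × Multiset ℕ) :
    arcSum f (p.1, (x + 1) ::ₘ p.2) q ≤ arcSum g (p.1, (x + 2) ::ₘ p.2) q := by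
  refine arcSum_le_arcSum rfl fun e => hfg _ _ ?_
  simp only [moveResult, Multiset.cons_add, Multiset.map_cons, Multiset.add_cons, Nat.pred_succ,
    Multiset.card_cons]
  exact covers_dropZeros_left _ _ _

theorem arcSum_keep_right (x : ℕ) (p q : Multiset ℕ × Multiset ℕ) :
    arcSum f p (x ::ₘ q.1, q.2) ≤ arcSum g p ((x + 1) ::ₘ q.1, q.2) := by
  refine arcSum_le_arcSum rfl fun e => hfg _ _ ?_
  simp only [moveResult, Multiset.cons_add]
  exact covers_dropZeros_right _ _ _

theorem arcSum_decrement_right (x : ℕ) (p q : Multiset ℕ × Multiset ℕ) :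
    arcSum f p (q.1, (x + 1) ::ₘ q.2) ≤ arcSum g p (q.1, (x + 2) ::ₘ q.2) := by
  refine arcSum_le_arcSum (by simp) fun e => hfg _ _ ?_
  simp only [moveResult, Multiset.cons_add, Multiset.map_cons, Multiset.add_cons, Nat.pred_succ,
    Multiset.card_cons]
  exact covers_dropZeros_right _ _ _

/-- A unit that is decremented to zero leaves the moves in which it is chosen as surplus. -/
theorem sum_map_moves_add_le_of_one (U V : Multiset ℕ) :
    ((moves (U, V)).map f).sum + (U.antidiagonal.map fun p => (V.antidiagonal.map fun q =>
      arcSum g (p.1, 1 ::ₘ p.2) q).sum).sum ≤ ((moves (1 ::ₘ U, V)).map g).sum := by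
  rw [sum_map_moves, sum_map_moves, Multiset.antidiagonal_cons]
  simp only [Multiset.map_add, Multiset.sum_add, Multiset.map_map, Function.comp_def, Prod.map, id]
  rw [add_comm]
  refine add_le_add_right (Multiset.sum_map_le_sum_map _ _ fun p _ =>
    Multiset.sum_map_le_sum_map _ _ fun q _ => ?_) _
  refine le_trans (le_of_eq ?_) (arcSum_keep_left hfg 0 p q)
  simp only [arcSum, moveResult, Multiset.cons_add, dropZeros_cons_zero]

/-- If the enlarged element already exists in `T`, moves are matched by treating it alike in `S`. If
it is a new `1`, the moves of `T` match those of `S` that keep it, and the remaining moves of `S`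
contribute non-negatively. -/
theorem sum_map_moves_le (hg : ∀ S, 0 ≤ g S) {S T : Multiset ℕ × Multiset ℕ} (h : Covers S T) :
    ((moves T).map f).sum ≤ ((moves S).map g).sum := by
  obtain ⟨x, U, V, hU, ⟨rfl, rfl⟩ | ⟨rfl, rfl⟩⟩ := h
  · rcases x with _ | x
    · rw [dropZeros_cons_zero, dropZeros_of_zero_notMem hU]
      refine le_trans (le_add_of_nonneg_right ?_) (sum_map_moves_add_le_of_one hfg U V)
      refine Multiset.sum_nonneg ?_
      simp only [Multiset.mem_map]
      rintro _ ⟨p, -, rfl⟩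
      refine Multiset.sum_nonneg ?_
      simp only [Multiset.mem_map]
      rintro _ ⟨q, -, rfl⟩
      exact arcSum_nonneg hg _ _
    · rw [dropZeros_cons_succ, dropZeros_of_zero_notMem hU, sum_map_moves, sum_map_moves,
        Multiset.antidiagonal_cons, Multiset.antidiagonal_cons]
      simp only [Multiset.map_add, Multiset.sum_add, Multiset.map_map, Function.comp_def,
        Prod.map, id]
      exact add_le_add
        (Multiset.sum_map_le_sum_map _ _ fun p _ => Multiset.sum_map_le_sum_map _ _ fun q _ =>
          arcSum_decrement_left hfg x p q)
        (Multiset.sum_map_le_sum_map _ _ fun p _ => Multiset.sum_map_le_sum_map _ _ fun q _ =>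
          arcSum_keep_left hfg (x + 1) p q)
  · rw [sum_map_moves, sum_map_moves]
    refine Multiset.sum_map_le_sum_map _ _ fun p _ => ?_
    rcases x with _ | x
    · rw [dropZeros_cons_zero, dropZeros_of_zero_notMem hU, Multiset.antidiagonal_cons]
      simp only [Multiset.map_add, Multiset.sum_add, Multiset.map_map, Function.comp_def,
        Prod.map, id]
      refine le_trans ?_ (le_add_of_nonneg_left (Multiset.sum_nonneg ?_))
      · refine Multiset.sum_map_le_sum_map _ _ fun q _ => ?_
        refine le_trans (le_of_eq ?_) (arcSum_keep_right hfg 0 p q)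
        simp only [arcSum, moveResult, Multiset.cons_add, dropZeros_cons_zero]
      · simp only [Multiset.mem_map]
        rintro _ ⟨q, -, rfl⟩
        exact arcSum_nonneg hg _ _
    · rw [dropZeros_cons_succ, dropZeros_of_zero_notMem hU, Multiset.antidiagonal_cons,
        Multiset.antidiagonal_cons]
      simp only [Multiset.map_add, Multiset.sum_add, Multiset.map_map, Function.comp_def,
        Prod.map, id]
      exact add_le_add
        (Multiset.sum_map_le_sum_map _ _ fun q _ => arcSum_decrement_right hfg x p q)
        (Multiset.sum_map_le_sum_map _ _ fun q _ => arcSum_keep_right hfg (x + 1) p q)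

end Covering

/-! ### The arcs added by an extension and their effect on excesses -/

section Arcs

theorem mem_U_inl {n i : ℕ} : (Sum.inl i : Vertex) ∈ U n ↔ 1 ≤ i ∧ i ≤ n := by simp [U]

theorem mem_U_inr {n i : ℕ} : (Sum.inr i : Vertex) ∈ U n ↔ 1 ≤ i ∧ i ≤ n := by simp [U]

theorem inl_inr_mem_arcs {n i j : ℕ} :
    ((Sum.inl i, Sum.inr j) : Vertex × Vertex) ∈ arcs n ↔ 1 ≤ i ∧ i ≤ j ∧ j ≤ n := by
  simp [arcs]; omega

theorem inr_inl_mem_arcs {n i j : ℕ} :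
    ((Sum.inr j, Sum.inl i) : Vertex × Vertex) ∈ arcs n ↔ 1 ≤ j ∧ j < i ∧ i ≤ n := by
  simp [arcs]; omega

theorem inl_inl_notMem_arcs {n i j : ℕ} :
    ((Sum.inl i, Sum.inl j) : Vertex × Vertex) ∉ arcs n := by
  simp [arcs]

theorem inr_inr_notMem_arcs {n i j : ℕ} :
    ((Sum.inr i, Sum.inr j) : Vertex × Vertex) ∉ arcs n := by
  simp [arcs]

/-- The contribution of an arc to the excess of a vertex. -/
def arcContribution (v : Vertex) (e : Vertex × Vertex) : ℤ :=
  (if e.2 = v then 1 else 0) - (if e.1 = v then 1 else 0)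

theorem excess_eq_sum (k : ℕ) (X : Finset (Vertex × Vertex)) (v : Vertex) :
    excess k X v = (if v = Sum.inl 1 then (k : ℤ) else 0) + ∑ e ∈ X, arcContribution v e := by
  simp only [excess, inDeg, outDeg, arcContribution, Finset.sum_sub_distrib, Finset.sum_boole]
  ring

/-- The arcs which leave `a_i`, `i ∈ A`, to `b_{ℓ+1}`, those which leave `b_j`, `j ∈ B`, to
`a_{ℓ+1}`, and, if `e = 1`, the arc from `a_{ℓ+1}` to `b_{ℓ+1}`. -/
def extend (ℓ : ℕ) (X : Finset (Vertex × Vertex)) (A B : Finset ℕ) (e : ℕ) :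
    Finset (Vertex × Vertex) :=
  X ∪ (A.image (fun i => (Sum.inl i, Sum.inr (ℓ + 1))) ∪
    (B.image (fun j => (Sum.inr j, Sum.inl (ℓ + 1))) ∪
      if e = 1 then {(Sum.inl (ℓ + 1), Sum.inr (ℓ + 1))} else ∅))

variable {k ℓ : ℕ} {X : Finset (Vertex × Vertex)} {A B : Finset ℕ} {e : ℕ}

theorem inl_inr_mem_extend {i j : ℕ} :
    ((Sum.inl i, Sum.inr j) : Vertex × Vertex) ∈ extend ℓ X A B e ↔
      (Sum.inl i, Sum.inr j) ∈ X ∨ (i ∈ A ∧ j = ℓ + 1) ∨ (e = 1 ∧ i = ℓ + 1 ∧ j = ℓ + 1) := by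
  by_cases h : e = 1 <;> simp [extend, h, eq_comm]
  tauto

theorem inr_inl_mem_extend {i j : ℕ} :
    ((Sum.inr j, Sum.inl i) : Vertex × Vertex) ∈ extend ℓ X A B e ↔
      (Sum.inr j, Sum.inl i) ∈ X ∨ (j ∈ B ∧ i = ℓ + 1) := by
  by_cases h : e = 1 <;> simp [extend, h, eq_comm]

theorem inl_inl_mem_extend {i j : ℕ} :
    ((Sum.inl i, Sum.inl j) : Vertex × Vertex) ∈ extend ℓ X A B e ↔
      (Sum.inl i, Sum.inl j) ∈ X := by
  by_cases h : e = 1 <;> simp [extend, h]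

theorem inr_inr_mem_extend {i j : ℕ} :
    ((Sum.inr i, Sum.inr j) : Vertex × Vertex) ∈ extend ℓ X A B e ↔
      (Sum.inr i, Sum.inr j) ∈ X := by
  by_cases h : e = 1 <;> simp [extend, h]

theorem extend_subset_arcs (hX : X ⊆ arcs ℓ) (hA : A ⊆ Finset.Icc 1 ℓ) (hB : B ⊆ Finset.Icc 1 ℓ) :
    extend ℓ X A B e ⊆ arcs (ℓ + 1) := by
  rintro ⟨i | i, j | j⟩ h
  · exact absurd (hX (inl_inl_mem_extend.1 h)) inl_inl_notMem_arcs
  · rw [inl_inr_mem_arcs]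
    rcases inl_inr_mem_extend.1 h with h | ⟨hi, rfl⟩ | ⟨-, rfl, rfl⟩
    · have := inl_inr_mem_arcs.1 (hX h); omega
    · have := Finset.mem_Icc.1 (hA hi); omega
    · omega
  · rw [inr_inl_mem_arcs]
    rcases inr_inl_mem_extend.1 h with h | ⟨hi, rfl⟩
    · have := inr_inl_mem_arcs.1 (hX h); omega
    · have := Finset.mem_Icc.1 (hB hi); omega
  · exact absurd (hX (inr_inr_mem_extend.1 h)) inr_inr_notMem_arcs

theorem induced_extend (hX : X ⊆ arcs ℓ) : induced ℓ (extend ℓ X A B e) = X := by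
  ext ⟨i | i, j | j⟩
  · simp only [induced, Finset.mem_filter, inl_inl_mem_extend]
    exact ⟨fun h => h.1, fun h => absurd (hX h) inl_inl_notMem_arcs⟩
  · simp only [induced, Finset.mem_filter, inl_inr_mem_extend, mem_U_inl, mem_U_inr]
    constructor
    · rintro ⟨h | h | h, h'⟩
      · exact h
      · omega
      · omega
    · intro h
      have := inl_inr_mem_arcs.1 (hX h)
      exact ⟨.inl h, by omega⟩
  · simp only [induced, Finset.mem_filter, inr_inl_mem_extend, mem_U_inl, mem_U_inr]
    constructor
    · rintro ⟨h | h, h'⟩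
      · exact h
      · omega
    · intro h
      have := inr_inl_mem_arcs.1 (hX h)
      exact ⟨.inl h, by omega⟩
  · simp only [induced, Finset.mem_filter, inr_inr_mem_extend]
    exact ⟨fun h => h.1, fun h => absurd (hX h) inr_inr_notMem_arcs⟩

/-- Every arc of `F_{ℓ+1}` outside `F_ℓ` ends at `b_{ℓ+1}` or `a_{ℓ+1}`, so the new arcs are encoded
by two index sets and one bit. -/
theorem eq_extend_of_induced_eq {Y : Finset (Vertex × Vertex)} (hY : Y ⊆ arcs (ℓ + 1))
    (h : induced ℓ Y = X) :
    Y = extend ℓ X ((Finset.Icc 1 ℓ).filter fun i => (Sum.inl i, Sum.inr (ℓ + 1)) ∈ Y)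
      ((Finset.Icc 1 ℓ).filter fun j => (Sum.inr j, Sum.inl (ℓ + 1)) ∈ Y)
      (if (Sum.inl (ℓ + 1), Sum.inr (ℓ + 1)) ∈ Y then 1 else 0) := by
  subst h
  ext ⟨i | i, j | j⟩
  · rw [inl_inl_mem_extend]
    exact ⟨fun h => absurd (hY h) inl_inl_notMem_arcs, fun h => (Finset.mem_filter.1 h).1⟩
  · simp only [inl_inr_mem_extend, induced, Finset.mem_filter, mem_U_inl, mem_U_inr,
      Finset.mem_Icc]
    constructor
    · intro h
      have := inl_inr_mem_arcs.1 (hY h)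
      rcases Nat.lt_or_ge j (ℓ + 1) with hj | hj
      · exact .inl ⟨h, by omega, by omega⟩
      · obtain rfl : j = ℓ + 1 := by omega
        rcases Nat.lt_or_ge i (ℓ + 1) with hi | hi
        · exact .inr (.inl ⟨⟨by omega, h⟩, rfl⟩)
        · obtain rfl : i = ℓ + 1 := by omega
          exact .inr (.inr ⟨if_pos h, rfl, rfl⟩)
    · rintro (h | ⟨h, rfl⟩ | ⟨h, rfl, rfl⟩)
      · exact h.1
      · exact h.2
      · by_contra h'
        simp [h'] at h
  · simp only [inr_inl_mem_extend, induced, Finset.mem_filter, mem_U_inl, mem_U_inr,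
      Finset.mem_Icc]
    constructor
    · intro h
      have := inr_inl_mem_arcs.1 (hY h)
      rcases Nat.lt_or_ge j (ℓ + 1) with hj | hj
      · exact .inl ⟨h, by omega, by omega⟩
      · obtain rfl : j = ℓ + 1 := by omega
        exact .inr ⟨⟨by omega, h⟩, rfl⟩
    · rintro (h | ⟨h, rfl⟩)
      · exact h.1
      · exact h.2
  · rw [inr_inr_mem_extend]
    exact ⟨fun h => absurd (hY h) inr_inr_notMem_arcs, fun h => (Finset.mem_filter.1 h).1⟩

/-- The bounds on `A` and `A'` exclude the index `ℓ + 1`, which would encode the same arc as `e =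
1`. -/
theorem extend_injective {A' B' : Finset ℕ} {e' : ℕ} (hX : X ⊆ arcs ℓ)
    (hA : A ⊆ Finset.Icc 1 ℓ) (hA' : A' ⊆ Finset.Icc 1 ℓ) (he : e ≤ 1) (he' : e' ≤ 1)
    (h : extend ℓ X A B e = extend ℓ X A' B' e') : A = A' ∧ B = B' ∧ e = e' := by
  have h1 : ∀ i, ((Sum.inl i, Sum.inr (ℓ + 1)) : Vertex × Vertex) ∉ X := fun i hi => by
    have := inl_inr_mem_arcs.1 (hX hi); omega
  have h2 : ∀ i, ((Sum.inr i, Sum.inl (ℓ + 1)) : Vertex × Vertex) ∉ X := fun i hi => by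
    have := inr_inl_mem_arcs.1 (hX hi); omega
  have h3 : ∀ {A : Finset ℕ}, A ⊆ Finset.Icc 1 ℓ → ℓ + 1 ∉ A := fun hA hi => by
    have := Finset.mem_Icc.1 (hA hi); omega
  have hl : ∀ i, (i ∈ A ∨ (e = 1 ∧ i = ℓ + 1)) ↔ (i ∈ A' ∨ (e' = 1 ∧ i = ℓ + 1)) := fun i => by
    have := Finset.ext_iff.1 h (Sum.inl i, Sum.inr (ℓ + 1))
    simpa [inl_inr_mem_extend, h1] using this
  refine ⟨?_, ?_, ?_⟩
  · ext i
    rcases eq_or_ne i (ℓ + 1) with rfl | hi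
    · simp [h3 hA, h3 hA']
    · simpa [hi] using hl i
  · ext j
    have := Finset.ext_iff.1 h (Sum.inr j, Sum.inl (ℓ + 1))
    simpa [inr_inl_mem_extend, h2] using this
  · have := hl (ℓ + 1)
    simp only [h3 hA, h3 hA', false_or, and_true] at this
    omega

theorem excess_extend (hX : X ⊆ arcs ℓ) (hA : A ⊆ Finset.Icc 1 ℓ) (v : Vertex) :
    excess k (extend ℓ X A B e) v = excess k X v +
      ∑ i ∈ A, arcContribution v (Sum.inl i, Sum.inr (ℓ + 1)) +
      ∑ j ∈ B, arcContribution v (Sum.inr j, Sum.inl (ℓ + 1)) +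
      if e = 1 then arcContribution v (Sum.inl (ℓ + 1), Sum.inr (ℓ + 1)) else 0 := by
  have h1 : ∀ i, ((Sum.inl i, Sum.inr (ℓ + 1)) : Vertex × Vertex) ∉ X := fun i hi => by
    have := inl_inr_mem_arcs.1 (hX hi); omega
  have h2 : ∀ i, ((Sum.inr i, Sum.inl (ℓ + 1)) : Vertex × Vertex) ∉ X := fun i hi => by
    have := inr_inl_mem_arcs.1 (hX hi); omega
  have h3 : ℓ + 1 ∉ A := fun hi => by have := Finset.mem_Icc.1 (hA hi); omega
  rw [excess_eq_sum, excess_eq_sum, extend, Finset.sum_union, Finset.sum_union, Finset.sum_union,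
    Finset.sum_image (by simp), Finset.sum_image (by simp)]
  · split_ifs <;> simp <;> ring
  all_goals
    rw [Finset.disjoint_left]
    rintro ⟨i | i, j | j⟩ h h'
    all_goals split_ifs at h' <;> simp_all
  all_goals aesop

theorem excess_extend_inl (hX : X ⊆ arcs ℓ) (hA : A ⊆ Finset.Icc 1 ℓ) {i : ℕ} (hi : i ≤ ℓ) :
    excess k (extend ℓ X A B e) (Sum.inl i) =
      excess k X (Sum.inl i) - if i ∈ A then 1 else 0 := by
  have : ¬ ℓ + 1 = i := by omega
  rw [excess_extend hX hA]
  simp [arcContribution, this]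
  ring

theorem excess_extend_inr (hX : X ⊆ arcs ℓ) (hA : A ⊆ Finset.Icc 1 ℓ) {i : ℕ} (hi : i ≤ ℓ) :
    excess k (extend ℓ X A B e) (Sum.inr i) =
      excess k X (Sum.inr i) - if i ∈ B then 1 else 0 := by
  have : ¬ ℓ + 1 = i := by omega
  rw [excess_extend hX hA]
  simp [arcContribution, this]
  ring

theorem excess_eq_zero_of_subset_arcs (hℓ : 1 ≤ ℓ) (hX : X ⊆ arcs ℓ) {v : Vertex}
    (hv : v = Sum.inl (ℓ + 1) ∨ v = Sum.inr (ℓ + 1)) : excess k X v = 0 := by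
  have h1 : v ≠ Sum.inl 1 := by
    rcases hv with rfl | rfl
    · simp only [ne_eq, Sum.inl.injEq]; omega
    · simp
  rw [excess_eq_sum, if_neg h1, zero_add]
  refine Finset.sum_eq_zero fun a ha => ?_
  have h2 := hX ha
  obtain ⟨i | i, j | j⟩ := a
  · exact absurd h2 inl_inl_notMem_arcs
  · rw [inl_inr_mem_arcs] at h2
    rcases hv with rfl | rfl <;> simp [arcContribution] <;> omega
  · rw [inr_inl_mem_arcs] at h2
    rcases hv with rfl | rfl <;> simp [arcContribution] <;> omega
  · exact absurd h2 inr_inr_notMem_arcs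

theorem excess_extend_inl_new (hℓ : 1 ≤ ℓ) (hX : X ⊆ arcs ℓ) (hA : A ⊆ Finset.Icc 1 ℓ)
    (he : e ≤ 1) : excess k (extend ℓ X A B e) (Sum.inl (ℓ + 1)) = B.card - e := by
  have h3 : ℓ + 1 ∉ A := fun hi => by have := Finset.mem_Icc.1 (hA hi); omega
  rw [excess_extend hX hA, excess_eq_zero_of_subset_arcs hℓ hX (.inl rfl)]
  interval_cases e <;> simp [arcContribution, h3]
  ring

theorem excess_extend_inr_new (hℓ : 1 ≤ ℓ) (hX : X ⊆ arcs ℓ) (hA : A ⊆ Finset.Icc 1 ℓ)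
    (hB : B ⊆ Finset.Icc 1 ℓ)
    (he : e ≤ 1) : excess k (extend ℓ X A B e) (Sum.inr (ℓ + 1)) = A.card + e := by
  have h3 : ℓ + 1 ∉ B := fun hi => by have := Finset.mem_Icc.1 (hB hi); omega
  rw [excess_extend hX hA, excess_eq_zero_of_subset_arcs hℓ hX (.inr rfl)]
  interval_cases e <;> simp [arcContribution, h3]

end Arcs

/-! ### Counting extensions by moves -/

section Types

variable {k ℓ : ℕ} {X : Finset (Vertex × Vertex)} {A B : Finset ℕ} {e : ℕ}

/-- The amounts terminating at the `a`s, as natural numbers. -/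
def amountA (k : ℕ) (X : Finset (Vertex × Vertex)) (i : ℕ) : ℕ := (excess k X (Sum.inl i)).toNat

/-- The amounts terminating at the `b`s, as natural numbers. -/
def amountB (k : ℕ) (X : Finset (Vertex × Vertex)) (i : ℕ) : ℕ := (excess k X (Sum.inr i)).toNat

/-- The type of a flow as a pair of multisets of natural numbers. -/
def flowType (k ℓ : ℕ) (X : Finset (Vertex × Vertex)) : Multiset ℕ × Multiset ℕ :=
  (dropZeros ((Finset.Icc 1 ℓ).val.map (amountA k X)),
    dropZeros ((Finset.Icc 1 ℓ).val.map (amountB k X)))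

theorem filter_map_eq_map_cast_iff {s : Multiset ℕ} {f : ℕ → ℤ} (hf : ∀ i ∈ s, 0 ≤ f i)
    {R : Multiset ℕ} : (s.map f).filter (fun c => c ≠ 0) = R.map Nat.cast ↔
      dropZeros (s.map fun i => (f i).toNat) = R := by
  have h : (s.map f).filter (fun c => c ≠ 0) =
      (dropZeros (s.map fun i => (f i).toNat)).map Nat.cast := by
    rw [dropZeros, Multiset.filter_map, Multiset.filter_map, Multiset.map_map]
    have h1 : s.filter ((fun c => c ≠ 0) ∘ f) =
        s.filter ((fun c => c ≠ 0) ∘ fun i => (f i).toNat) := by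
      refine Multiset.filter_congr fun i hi => ?_
      have := hf i hi
      simp only [Function.comp]
      omega
    rw [h1]
    refine Multiset.map_congr rfl fun i hi => ?_
    exact (Int.toNat_of_nonneg (hf i (Multiset.mem_of_mem_filter hi))).symm
  rw [h]
  exact (Multiset.map_injective Nat.cast_injective).eq_iff

theorem IsFlow.hasType_iff (hX : IsFlow k ℓ X) {T : FlowType k} :
    HasType k ℓ X T ↔ flowType k ℓ X = T.1 := by
  have ha : ∀ i ∈ (Finset.Icc 1 ℓ).val, 0 ≤ excess k X (Sum.inl i) := fun i hi =>
    hX.2.2 _ (mem_U_inl.2 (Finset.mem_Icc.1 hi))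
  have hb : ∀ i ∈ (Finset.Icc 1 ℓ).val, 0 ≤ excess k X (Sum.inr i) := fun i hi =>
    hX.2.2 _ (mem_U_inr.2 (Finset.mem_Icc.1 hi))
  simp only [HasType, Multiset.map_id', Multiset.bind_def, Multiset.pure_def,
    Multiset.bind_singleton]
  rw [filter_map_eq_map_cast_iff ha, filter_map_eq_map_cast_iff hb, flowType,
    Prod.ext_iff]
  rfl

/-- An old vertex loses at most one unit, so it needs a positive amount exactly when it is chosen.
The new `a` keeps `B.card - e`, which gives the last condition. -/
theorem isFlow_extend_iff (hX : IsFlow k ℓ X) (hA : A ⊆ Finset.Icc 1 ℓ)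
    (hB : B ⊆ Finset.Icc 1 ℓ) (he : e ≤ 1) :
    IsFlow k (ℓ + 1) (extend ℓ X A B e) ↔
      (∀ i ∈ A, amountA k X i ≠ 0) ∧ (∀ j ∈ B, amountB k X j ≠ 0) ∧ e ≤ B.card := by
  obtain ⟨hℓ, hXs, hpos⟩ := hX
  constructor
  · rintro ⟨-, -, h⟩
    refine ⟨fun i hi => ?_, fun j hj => ?_, ?_⟩
    · have hi' := Finset.mem_Icc.1 (hA hi)
      have := h (Sum.inl i) (mem_U_inl.2 (by omega))
      rw [excess_extend_inl hXs hA hi'.2, if_pos hi] at this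
      rw [amountA]; omega
    · have hj' := Finset.mem_Icc.1 (hB hj)
      have := h (Sum.inr j) (mem_U_inr.2 (by omega))
      rw [excess_extend_inr hXs hA hj'.2, if_pos hj] at this
      rw [amountB]; omega
    · have := h (Sum.inl (ℓ + 1)) (mem_U_inl.2 (by omega))
      rw [excess_extend_inl_new hℓ hXs hA he] at this
      omega
  · rintro ⟨h1, h2, h3⟩
    refine ⟨by omega, extend_subset_arcs hXs hA hB, ?_⟩
    rintro (i | i) hi
    · rw [mem_U_inl] at hi
      rcases Nat.lt_or_ge ℓ i with hl | hl
      · obtain rfl : i = ℓ + 1 := by omega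
        rw [excess_extend_inl_new hℓ hXs hA he]
        omega
      · rw [excess_extend_inl hXs hA hl]
        have := hpos _ (mem_U_inl.2 ⟨hi.1, hl⟩)
        split_ifs with h
        · have := h1 i h
          rw [amountA] at this; omega
        · omega
    · rw [mem_U_inr] at hi
      rcases Nat.lt_or_ge ℓ i with hl | hl
      · obtain rfl : i = ℓ + 1 := by omega
        rw [excess_extend_inr_new hℓ hXs hA hB he]
        omega
      · rw [excess_extend_inr hXs hA hl]
        have := hpos _ (mem_U_inr.2 ⟨hi.1, hl⟩)
        split_ifs with h
        · have := h2 i h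
          rw [amountB] at this; omega
        · omega

/-- The elements of `s` at which `f` does not vanish. -/
def support (s : Finset ℕ) (f : ℕ → ℕ) : Finset ℕ := s.filter fun i => f i ≠ 0

theorem dropZeros_map (s : Finset ℕ) (f : ℕ → ℕ) :
    dropZeros (s.val.map f) = (support s f).val.map f := by
  rw [dropZeros, Multiset.filter_map]
  rfl

theorem dropZeros_map_sub_indicator {s : Finset ℕ} {f : ℕ → ℕ} (hA : A ⊆ s) :
    dropZeros (s.val.map fun i => f i - if i ∈ A then 1 else 0) =
      dropZeros ((support s f \ A).val.map f + (A.val.map f).map Nat.pred) := by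
  have h1 : s.val = (s \ A).val + A.val := by
    rw [← Finset.disjUnion_val (h := Finset.sdiff_disjoint), Finset.disjUnion_eq_union,
      Finset.sdiff_union_of_subset hA]
  rw [h1, Multiset.map_add, dropZeros_add, dropZeros_add]
  congr 1
  · have h2 : (s \ A).val.map (fun i => f i - if i ∈ A then 1 else 0) = (s \ A).val.map f := by
      refine Multiset.map_congr rfl fun i hi => ?_
      rw [if_neg (Finset.mem_sdiff.1 hi).2, tsub_zero]
    rw [h2, dropZeros_map, dropZeros_map]
    congr 2
    ext i
    simp only [support, Finset.mem_filter, Finset.mem_sdiff]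
    tauto
  · congr 1
    rw [Multiset.map_map]
    refine Multiset.map_congr rfl fun i hi => ?_
    rw [if_pos (Finset.mem_def.2 hi)]
    rfl

theorem Icc_succ_val (ℓ : ℕ) (f : ℕ → ℕ) : (Finset.Icc 1 (ℓ + 1)).val.map f =
    (Finset.Icc 1 ℓ).val.map f + {f (ℓ + 1)} := by
  have h : Finset.Icc 1 (ℓ + 1) = Finset.cons (ℓ + 1) (Finset.Icc 1 ℓ) (by simp) := by
    ext i; simp only [Finset.mem_Icc, Finset.mem_cons]; omega
  rw [h, Finset.cons_val, Multiset.map_cons, ← Multiset.singleton_add, add_comm]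

/-- The splitting of the nonzero values of `f` into the kept and the decremented ones. -/
def split (s : Finset ℕ) (f : ℕ → ℕ) (A : Finset ℕ) : Multiset ℕ × Multiset ℕ :=
  ((support s f \ A).val.map f, A.val.map f)

theorem flowType_extend (hX : IsFlow k ℓ X) (hA : A ⊆ Finset.Icc 1 ℓ)
    (hB : B ⊆ Finset.Icc 1 ℓ) (he : e ≤ 1) :
    flowType k (ℓ + 1) (extend ℓ X A B e) =
      moveResult (split (Finset.Icc 1 ℓ) (amountA k X) A)
        (split (Finset.Icc 1 ℓ) (amountB k X) B) e := by
  obtain ⟨hℓ, hXs, hpos⟩ := hX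
  have ha : (Finset.Icc 1 ℓ).val.map (amountA k (extend ℓ X A B e)) =
      (Finset.Icc 1 ℓ).val.map fun i => amountA k X i - if i ∈ A then 1 else 0 := by
    refine Multiset.map_congr rfl fun i hi => ?_
    rw [amountA, excess_extend_inl hXs hA (Finset.mem_Icc.1 hi).2, amountA]
    split_ifs <;> omega
  have hb : (Finset.Icc 1 ℓ).val.map (amountB k (extend ℓ X A B e)) =
      (Finset.Icc 1 ℓ).val.map fun i => amountB k X i - if i ∈ B then 1 else 0 := by
    refine Multiset.map_congr rfl fun i hi => ?_
    rw [amountB, excess_extend_inr hXs hA (Finset.mem_Icc.1 hi).2, amountB]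
    split_ifs <;> omega
  have ha' : amountA k (extend ℓ X A B e) (ℓ + 1) = B.card - e := by
    rw [amountA, excess_extend_inl_new hℓ hXs hA he]; omega
  have hb' : amountB k (extend ℓ X A B e) (ℓ + 1) = A.card + e := by
    rw [amountB, excess_extend_inr_new hℓ hXs hA hB he]; omega
  rw [flowType, Icc_succ_val, Icc_succ_val, dropZeros_add, dropZeros_add, ha, hb, ha', hb',
    dropZeros_map_sub_indicator hA, dropZeros_map_sub_indicator hB, ← dropZeros_add,
    ← dropZeros_add, moveResult]
  simp only [split, Multiset.card_map, Finset.card_val]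

/-- `Multiset.antidiagonal` lists splittings with multiplicity, one for each subset of the indices;
vertices with equal amounts are thus counted separately, as the count of flows requires. -/
theorem sum_map_antidiagonal_map (f : ℕ → ℕ) (P : Finset ℕ) : ∀ g : Multiset ℕ × Multiset ℕ → ℕ,
    ((P.val.map f).antidiagonal.map g).sum =
      ∑ A ∈ P.powerset, g ((P \ A).val.map f, A.val.map f) := by
  induction P using Finset.induction_on with
  | empty => intro g; simp
  | insert a P ha ih =>
    intro g
    rw [Finset.insert_val_of_notMem ha, Multiset.map_cons, Multiset.antidiagonal_cons,
      Multiset.map_add, Multiset.sum_add, Multiset.map_map, Multiset.map_map, ih, ih,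
      Finset.sum_powerset_insert ha, add_comm]
    have haA : ∀ A ∈ P.powerset, a ∉ A := fun A hA h => ha (Finset.mem_powerset.1 hA h)
    simp only [Function.comp, Prod.map, id]
    congr 1
    · refine Finset.sum_congr rfl fun A hA => ?_
      rw [Finset.insert_sdiff_of_notMem _ (haA A hA),
        Finset.insert_val_of_notMem (fun h => ha (Finset.mem_sdiff.1 h).1), Multiset.map_cons]
    · refine Finset.sum_congr rfl fun A hA => ?_
      rw [Finset.insert_sdiff_insert, Finset.sdiff_insert_of_notMem ha,
        Finset.insert_val_of_notMem (haA A hA), Multiset.map_cons]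

theorem count_moves_flowType (T : Multiset ℕ × Multiset ℕ) :
    (moves (flowType k ℓ X)).count T =
      ∑ A ∈ (support (Finset.Icc 1 ℓ) (amountA k X)).powerset,
        ∑ B ∈ (support (Finset.Icc 1 ℓ) (amountB k X)).powerset,
          ∑ e ∈ Finset.range (min B.card 1 + 1),
            if moveResult (split (Finset.Icc 1 ℓ) (amountA k X) A)
              (split (Finset.Icc 1 ℓ) (amountB k X) B) e = T then 1 else 0 := by
  simp only [moves, flowType, dropZeros_map, Multiset.count_bind, sum_map_antidiagonal_map]
  refine Finset.sum_congr rfl fun A _ => Finset.sum_congr rfl fun B _ => ?_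
  rw [Multiset.count_map, ← Multiset.countP_eq_card_filter, Finset.sum_boole, Nat.cast_id,
    Finset.card_def, Finset.filter_val, ← Multiset.countP_eq_card_filter, Multiset.card_map,
    Finset.card_val]
  exact Multiset.countP_congr rfl fun e _ => propext eq_comm

/-- The number of extensions is the multiplicity of the new type among the moves. -/
theorem extensionCount_eq_count (hX : IsFlow k ℓ X) (T : FlowType k) :
    extensionCount k ℓ X T = (moves (flowType k ℓ X)).count T.1 := by
  set Pa := support (Finset.Icc 1 ℓ) (amountA k X) with hPa
  set Pb := support (Finset.Icc 1 ℓ) (amountB k X) with hPb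
  have hXs := hX.2.1
  have hD : extensionCount k ℓ X T =
      ((Pa.powerset ×ˢ Pb.powerset ×ˢ Finset.range 2).filter fun t => t.2.2 ≤ t.2.1.card ∧
        moveResult (split (Finset.Icc 1 ℓ) (amountA k X) t.1)
          (split (Finset.Icc 1 ℓ) (amountB k X) t.2.1) t.2.2 = T.1).card := by
    symm
    refine Finset.card_nbij (fun t => extend ℓ X t.1 t.2.1 t.2.2) ?_ ?_ ?_
    · rintro ⟨A, B, e⟩ h
      simp only [Finset.mem_coe, Finset.mem_filter, Finset.mem_product, Finset.mem_powerset,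
        Finset.mem_range] at h ⊢
      obtain ⟨⟨hA, hB, he⟩, he', hT⟩ := h
      have hA' := hA.trans (Finset.filter_subset _ _)
      have hB' := hB.trans (Finset.filter_subset _ _)
      have hflow := (isFlow_extend_iff hX hA' hB' (Nat.le_of_lt_succ he)).2
        ⟨fun i hi => (Finset.mem_filter.1 (hA hi)).2, fun i hi => (Finset.mem_filter.1 (hB hi)).2,
          he'⟩
      refine ⟨extend_subset_arcs hXs hA' hB', hflow, induced_extend hXs, ?_⟩
      rw [hflow.hasType_iff, flowType_extend hX hA' hB' (Nat.le_of_lt_succ he), hT]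
    · rintro ⟨A, B, e⟩ h ⟨A', B', e'⟩ h' heq
      simp only [Finset.mem_coe, Finset.mem_filter, Finset.mem_product, Finset.mem_powerset,
        Finset.mem_range] at h h' heq
      obtain ⟨rfl, rfl, rfl⟩ := extend_injective hXs (h.1.1.trans (Finset.filter_subset _ _))
        (h'.1.1.trans (Finset.filter_subset _ _)) (Nat.le_of_lt_succ h.1.2.2)
        (Nat.le_of_lt_succ h'.1.2.2) heq
      rfl
    · intro Y hY
      simp only [Finset.mem_coe, Finset.mem_filter, Finset.mem_powerset] at hY
      obtain ⟨hYs, hflow, hind, hT⟩ := hY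
      set A := (Finset.Icc 1 ℓ).filter fun i =>
        ((Sum.inl i, Sum.inr (ℓ + 1)) : Vertex × Vertex) ∈ Y with hAdef
      set B := (Finset.Icc 1 ℓ).filter fun j =>
        ((Sum.inr j, Sum.inl (ℓ + 1)) : Vertex × Vertex) ∈ Y with hBdef
      set e := if ((Sum.inl (ℓ + 1), Sum.inr (ℓ + 1)) : Vertex × Vertex) ∈ Y then 1 else 0 with hedef
      have hYe : Y = extend ℓ X A B e := eq_extend_of_induced_eq hYs hind
      have hA : A ⊆ Finset.Icc 1 ℓ := Finset.filter_subset _ _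
      have hB : B ⊆ Finset.Icc 1 ℓ := Finset.filter_subset _ _
      have he : e ≤ 1 := by rw [hedef]; split_ifs <;> omega
      -- The three sets of data are defined from `Y`; forgetting this allows `Y` to be eliminated.
      clear_value A B e
      subst hYe
      obtain ⟨h1, h2, h3⟩ := (isFlow_extend_iff hX hA hB he).1 hflow
      rw [hflow.hasType_iff, flowType_extend hX hA hB he] at hT
      refine ⟨(A, B, e), ?_, rfl⟩
      simp only [Finset.mem_coe, Finset.mem_filter, Finset.mem_product, Finset.mem_powerset,
        Finset.mem_range]
      exact ⟨⟨fun i hi => Finset.mem_filter.2 ⟨hA hi, h1 i hi⟩,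
        fun i hi => Finset.mem_filter.2 ⟨hB hi, h2 i hi⟩, Nat.lt_succ_of_le he⟩, h3, hT⟩
  rw [hD, count_moves_flowType, Finset.card_filter, Finset.sum_product]
  refine Finset.sum_congr rfl fun A _ => ?_
  rw [Finset.sum_product]
  refine Finset.sum_congr rfl fun B _ => ?_
  -- The bound `min B.card 1` expresses both `e ≤ 1` and `e ≤ B.card`.
  have hr : Finset.range (min B.card 1 + 1) = (Finset.range 2).filter fun e => e ≤ B.card := by
    ext e; simp only [Finset.mem_range, Finset.mem_filter]; omega
  rw [hr, Finset.sum_filter]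
  exact Finset.sum_congr rfl fun e _ => ite_and _ _ _ _

end Types

/-! ### The type matrix is well defined and irreducible -/

section TypeMatrix

variable {k : ℕ}

theorem isTypeOf_flowType (T : FlowType k) : IsTypeOf k T.1 := T.2

theorem isFlow_empty (k : ℕ) : IsFlow k 1 ∅ := by
  refine ⟨le_rfl, Finset.empty_subset _, fun v _ => ?_⟩
  rw [excess_eq_sum, Finset.sum_empty, add_zero]
  split_ifs <;> omega

theorem flowType_empty (k : ℕ) : flowType k 1 ∅ = (dropZeros {k}, 0) := by
  simp [flowType, amountA, amountB, excess_eq_sum, dropZeros_singleton_zero]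

theorem exists_isFlow_of_reach {T T' : Multiset ℕ × Multiset ℕ} (hT : IsTypeOf k T)
    (h : Reach T T') (hX : ∃ ℓ X, IsFlow k ℓ X ∧ flowType k ℓ X = T) :
    IsTypeOf k T' ∧ ∃ ℓ X, IsFlow k ℓ X ∧ flowType k ℓ X = T' := by
  induction h with
  | refl => exact ⟨hT, hX⟩
  | tail _ hmem ih =>
    obtain ⟨hS, ℓ, X, hX, rfl⟩ := ih
    have hS' := hS.of_mem_moves hmem
    have hpos : 0 < extensionCount k ℓ X ⟨_, hS'⟩ := by
      rw [extensionCount_eq_count hX]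
      exact Multiset.count_pos.2 hmem
    obtain ⟨Y, hY⟩ := Finset.card_pos.1 hpos
    obtain ⟨-, hflow, -, htype⟩ := Finset.mem_filter.1 hY
    exact ⟨hS', ℓ + 1, Y, hflow, hflow.hasType_iff.1 htype⟩

/-- The empty flow on `U_1` leaves all `k` units at `a_1`. Every type is reachable from its type,
and each move is realised by an extension. -/
theorem exists_isFlow_hasType (T : FlowType k) : ∃ ℓ X, IsFlow k ℓ X ∧ HasType k ℓ X T := by
  have h0 : IsTypeOf k (dropZeros {k}, 0) := isTypeOf_iff.2
    ⟨zero_notMem_dropZeros {k}, by simp, by simp [sum_dropZeros]⟩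
  obtain ⟨-, ℓ, X, hX, hT⟩ := exists_isFlow_of_reach h0 (h0.reach (isTypeOf_flowType T))
    ⟨1, ∅, isFlow_empty k, flowType_empty k⟩
  exact ⟨ℓ, X, hX, hX.hasType_iff.2 hT⟩

theorem typeMatrix_apply (T T' : FlowType k) :
    typeMatrix k T T' = (moves T.1).count T'.1 := by
  have h : IsFlow k (someFlow k T).1 (someFlow k T).2 ∧
      HasType k (someFlow k T).1 (someFlow k T).2 T := by
    obtain ⟨ℓ, X, hX⟩ := exists_isFlow_hasType T
    exact Classical.epsilon_spec (p := fun p : ℕ × Finset (Vertex × Vertex) =>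
      IsFlow k p.1 p.2 ∧ HasType k p.1 p.2 T) ⟨(ℓ, X), hX⟩
  rw [typeMatrix, Matrix.of_apply, extensionCount_eq_count h.1, h.1.hasType_iff.1 h.2]

theorem typeMatrixWellDefined (k : ℕ) : TypeMatrixWellDefined k := by
  refine fun T => ⟨exists_isFlow_hasType T, fun ℓ X hX hT T' => ?_⟩
  rw [typeMatrix_apply, extensionCount_eq_count hX, hX.hasType_iff.1 hT]

theorem typeMatrix_nonneg (T T' : FlowType k) : 0 ≤ typeMatrix k T T' := by
  rw [typeMatrix_apply]
  exact Nat.cast_nonneg _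

theorem one_le_typeMatrix_diag (T : FlowType k) : 1 ≤ typeMatrix k T T := by
  rw [typeMatrix_apply]
  exact_mod_cast Multiset.count_pos.2 (self_mem_moves (isTypeOf_flowType T))

theorem typeMatrix_irreducible (T T' : FlowType k) :
    Relation.ReflTransGen (fun T T' => 0 < typeMatrix k T T') T T' := by
  have key : ∀ {S S' : Multiset ℕ × Multiset ℕ}, Reach S S' → ∀ hS : IsTypeOf k S,
      ∃ hS' : IsTypeOf k S', Relation.ReflTransGen (fun T T' => 0 < typeMatrix k T T')
        (⟨S, hS⟩ : FlowType k) ⟨S', hS'⟩ := by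
    intro S S' h hS
    induction h with
    | refl => exact ⟨hS, .refl⟩
    | tail _ hmem ih =>
      obtain ⟨hU, h⟩ := ih
      refine ⟨hU.of_mem_moves hmem, h.tail ?_⟩
      rw [typeMatrix_apply]
      exact_mod_cast Multiset.count_pos.2 hmem
  exact (key ((isTypeOf_flowType T).reach (isTypeOf_flowType T')) T.2).2

instance (k : ℕ) : Nonempty (FlowType k) :=
  ⟨⟨(0, Multiset.replicate k 1), by simp, fun x hx => by
    rw [Multiset.eq_of_mem_replicate hx]; exact one_pos, by simp⟩⟩

open Classical in
/-- Extension by zero of a function on `FlowType k` to all pairs of multisets. -/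
noncomputable def extendZero (w : FlowType k → ℝ) (S : Multiset ℕ × Multiset ℕ) : ℝ :=
  if h : IsTypeOf k S then w ⟨S, h⟩ else 0

theorem extendZero_of_isTypeOf (w : FlowType k → ℝ) {S : Multiset ℕ × Multiset ℕ}
    (h : IsTypeOf k S) : extendZero w S = w ⟨S, h⟩ := dif_pos h

theorem extendZero_nonneg {w : FlowType k → ℝ} (hw : ∀ T, 0 < w T)
    (S : Multiset ℕ × Multiset ℕ) : 0 ≤ extendZero w S := by
  rw [extendZero]
  split_ifs with h
  · exact (hw _).le
  · exact le_rfl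

/-- Rewrites a row sum over types as a sum over the multiset of moves, where moves for `k` and `k +
1` can be matched without carrying membership proofs. -/
theorem sum_count_mul (w : FlowType k → ℝ) (m : Multiset (Multiset ℕ × Multiset ℕ)) :
    ∑ T : FlowType k, (m.count T.1 : ℝ) * w T = (m.map (extendZero w)).sum := by
  induction m using Multiset.induction_on with
  | empty => simp
  | cons S m ih =>
    rw [Multiset.map_cons, Multiset.sum_cons, ← ih]
    simp only [Multiset.count_cons, Nat.cast_add, add_mul, Finset.sum_add_distrib]
    rw [add_comm]
    congr 1
    by_cases h : IsTypeOf k S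
    · rw [extendZero_of_isTypeOf w h, Finset.sum_eq_single ⟨S, h⟩]
      · simp
      · intro T _ hT
        have : T.1 ≠ S := fun h' => hT (Subtype.ext h')
        simp [this]
      · simp
    · rw [extendZero, dif_neg h]
      refine Finset.sum_eq_zero fun T _ => ?_
      have : T.1 ≠ S := fun h' => h (h' ▸ isTypeOf_flowType T)
      simp [this]

theorem typeMatrix_mulVec (w : FlowType k → ℝ) (T : FlowType k) :
    (typeMatrix k).mulVec w T = ((moves T.1).map (extendZero w)).sum := by
  rw [← sum_count_mul]
  exact Finset.sum_congr rfl fun T' _ =>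
    congrArg (· * w T') (typeMatrix_apply T T')

end TypeMatrix

/-! ### Lifting the eigenvector from `k` to `k + 1` -/

section Comparison

variable {k : ℕ}

/-- Every function on the types of `k` is dominated, along coverings, by a function on the
types of `k + 1` whose values are attained. -/
theorem exists_lift_along_covers (v : FlowType k → ℝ) :
    ∃ w : FlowType (k + 1) → ℝ, (∀ S : FlowType (k + 1), ∃ T : FlowType k,
      Covers S.1 T.1 ∧ w S = v T) ∧ ∀ (S : FlowType (k + 1)) (T : FlowType k),
        Covers S.1 T.1 → v T ≤ w S := by
  have h : ∀ S : FlowType (k + 1), ∃ T : FlowType k, Covers S.1 T.1 ∧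
      ∀ T' : FlowType k, Covers S.1 T'.1 → v T' ≤ v T := by
    intro S
    obtain ⟨T, hT⟩ := exists_covers (isTypeOf_flowType S)
    obtain ⟨M, hM, hmax⟩ := Set.exists_max_image {T : FlowType k | Covers S.1 T.1} v
      (Set.toFinite _) ⟨⟨T, hT.isTypeOf_iff.1 (isTypeOf_flowType S)⟩, hT⟩
    exact ⟨M, hM, hmax⟩
  choose M hM hmax using h
  exact ⟨fun S => v (M S), fun S => ⟨M S, hM S, rfl⟩, hmax⟩

/-- The type with `k` terminating amounts, all equal to one and at the `a`s. -/
def onesType (k : ℕ) : FlowType k :=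
  ⟨(Multiset.replicate k 1, 0), fun x hx => by
    rw [Multiset.eq_of_mem_replicate hx]; exact one_pos, by simp, by simp⟩

theorem Covers.eq_of_onesType {T : Multiset ℕ × Multiset ℕ} (h : Covers (onesType (k + 1)).1 T) :
    T = (onesType k).1 := by
  obtain ⟨x, U, V, hU, ⟨h1, rfl⟩ | ⟨h1, rfl⟩⟩ := h
  · simp only [onesType, Prod.mk.injEq] at h1 ⊢
    obtain ⟨h1, rfl⟩ := h1
    have hx : x + 1 = 1 := Multiset.eq_of_mem_replicate (h1 ▸ Multiset.mem_cons_self _ _)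
    obtain rfl : x = 0 := by omega
    rw [zero_add, Multiset.replicate_succ, Multiset.cons_inj_right] at h1
    rw [dropZeros_cons_zero, dropZeros_of_zero_notMem hU]
    exact ⟨h1.symm, rfl⟩
  · simp [onesType] at h1

/-- If `w S = v T`, the comparison of moves bounds the image of `w` at `S` below by the image of `v`
at `T`, which is `r * v T = r * w S`. At `onesType (k + 1)` the extra unit is a new `1`, so the
surplus of moves that decrement it remains. -/
theorem typeMatrix_mulVec_lift {r : ℝ} {v : FlowType k → ℝ} {w : FlowType (k + 1) → ℝ}
    (hv : ∀ T, 0 < v T) (hev : (typeMatrix k).mulVec v = r • v)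
    (hw : ∀ S : FlowType (k + 1), ∃ T : FlowType k, Covers S.1 T.1 ∧ w S = v T)
    (hle : ∀ (S : FlowType (k + 1)) (T : FlowType k), Covers S.1 T.1 → v T ≤ w S) :
    r • w ≤ (typeMatrix (k + 1)).mulVec w ∧
      r * w (onesType (k + 1)) < (typeMatrix (k + 1)).mulVec w (onesType (k + 1)) := by
  have hwpos : ∀ S, 0 < w S := fun S => by
    obtain ⟨T, -, h⟩ := hw S
    rw [h]; exact hv T
  have hcov : ∀ S T, Covers S T → extendZero v T ≤ extendZero w S := by
    intro S T h
    by_cases hT : IsTypeOf k T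
    · rw [extendZero_of_isTypeOf v hT, extendZero_of_isTypeOf w (h.isTypeOf_iff.2 hT)]
      exact hle ⟨S, _⟩ ⟨T, hT⟩ h
    · rw [extendZero, dif_neg hT]
      exact extendZero_nonneg hwpos S
  have hev' : ∀ T : FlowType k, ((moves T.1).map (extendZero v)).sum = r * v T := fun T => by
    rw [← typeMatrix_mulVec, hev]; rfl
  constructor
  · intro S
    obtain ⟨T, hT, h⟩ := hw S
    rw [Pi.smul_apply, smul_eq_mul, h, ← hev' T, typeMatrix_mulVec]
    exact sum_map_moves_le hcov (extendZero_nonneg hwpos) hT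
  · obtain ⟨T, hT, h⟩ := hw (onesType (k + 1))
    rw [h, ← hev' T, typeMatrix_mulVec, hT.eq_of_onesType]
    have h1 := sum_map_moves_add_le_of_one hcov (Multiset.replicate k 1) 0
    rw [← Multiset.replicate_succ] at h1
    refine lt_of_lt_of_le (lt_add_of_pos_right _ ?_) h1
    set F := fun p : Multiset ℕ × Multiset ℕ => ((Multiset.antidiagonal 0).map fun q =>
      arcSum (extendZero w) (p.1, 1 ::ₘ p.2) q).sum with hF
    have hF0 : ∀ p, F p = arcSum (extendZero w) (p.1, 1 ::ₘ p.2) (0, 0) := fun p => by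
      simp [hF]
    have hmem : ((Multiset.replicate k 1, 0) : Multiset ℕ × Multiset ℕ) ∈
        (Multiset.replicate k 1).antidiagonal := by simp
    refine lt_of_lt_of_le ?_ (Multiset.single_le_sum ?_ _ (Multiset.mem_map_of_mem F hmem))
    · rw [hF0, arcSum]
      -- One positive surplus term suffices: the move that decrements only the extra `1` and uses no
      -- arc between the new vertices.
      have hres : moveResult (Multiset.replicate k 1, 1 ::ₘ 0) (0, 0) 0 ∈
          moves (onesType (k + 1)).1 := by
        refine mem_moves.2 ⟨_, _, 0, ?_, ?_, by simp, by simp, rfl⟩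
        · simp only [onesType, Multiset.add_cons, add_zero, Multiset.replicate_succ]
        · simp [onesType]
      have := (isTypeOf_flowType (onesType (k + 1))).of_mem_moves hres
      have h2 := hwpos ⟨_, this⟩
      rw [← extendZero_of_isTypeOf w this] at h2
      simpa using h2
    · simp only [Multiset.mem_map]
      rintro _ ⟨p, -, rfl⟩
      rw [hF0]
      exact arcSum_nonneg (extendZero_nonneg hwpos) _ _

end Comparison

end HalfGraphFlow

theorem mainTheorem3 (k : ℕ) :
    HalfGraphFlow.TypeMatrixWellDefined k ∧
    ∃ r s : ℝ,
      HalfGraphFlow.IsPerronEigenvalue (HalfGraphFlow.typeMatrix k) r ∧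
      HalfGraphFlow.IsPerronEigenvalue (HalfGraphFlow.typeMatrix (k + 1)) s ∧
      r < s := by
  open HalfGraphFlow in
  refine ⟨typeMatrixWellDefined k, ?_⟩
  obtain ⟨r, v, hr, hv, hev, hcw⟩ := exists_collatzWielandt (A := typeMatrix k)
    typeMatrix_nonneg one_le_typeMatrix_diag typeMatrix_irreducible
  obtain ⟨s, u, hs, hu, heu, hcw'⟩ := exists_collatzWielandt (A := typeMatrix (k + 1))
    typeMatrix_nonneg one_le_typeMatrix_diag typeMatrix_irreducible
  have hne : ∀ {n : ℕ} {x : FlowType n → ℝ}, (∀ T, 0 < x T) → x ≠ 0 := fun hx h =>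
    (hx (onesType _)).ne' (congrFun h _)
  refine ⟨r, s, isPerronEigenvalue_of_collatzWielandt typeMatrix_nonneg one_le_typeMatrix_diag hr
    (hne hv) hev hcw, isPerronEigenvalue_of_collatzWielandt typeMatrix_nonneg
    one_le_typeMatrix_diag hs (hne hu) heu hcw', ?_⟩
  obtain ⟨w, hw, hle⟩ := exists_lift_along_covers v
  have hwpos : ∀ S, 0 < w S := fun S => by
    obtain ⟨T, -, h⟩ := hw S
    rw [h]; exact hv T
  obtain ⟨h1, h2⟩ := typeMatrix_mulVec_lift hv hev hw hle
  -- The strict coordinate at `onesType (k + 1)` shows that `w` is not an eigenvector for `r`, so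
  -- some constant larger than `r` is subinvariant and hence at most `s`.
  obtain ⟨d, hd, y, hy, hy0, hdy⟩ := exists_larger_subinvariant typeMatrix_nonneg
    one_le_typeMatrix_diag typeMatrix_irreducible (fun S => (hwpos S).le) (hne hwpos) h1
    fun h => h2.ne' (congrFun h _)
  exact lt_of_lt_of_le hd (hcw' d y hy hy0 hdy)
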